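/- **Model.** The input is a simple undirected graph $G=(V,E)$ with $n=|V|\ge 1$ vertices, $m=|E|$ edges and no isolated vertices; its average degree is $d=2m/n$. The number $n$ is known. The vertices carry distinct natural-number identifiers unknown to the algorithm, and $G$ is accessed only through the following queries, whose random answers are all independent: $\mathbf{RandVert}$ (a uniformly random vertex), $\mathbf{RandNbr}(x)$ (a uniformly random neighbor of $x$), $\mathbf{Degree}(x)$ (the degree of $x$), $\mathbf{RandEdge}$ (a uniformly random edge), and, in addition, either $\mathbf{Pair}(x,y)$ (whether $\{x,y\}\in E$) or $\mathbf{Additive}(S)$ for a finite set $S$ of vertices (the number of edges with both endpoints in $S$). The query $\mathbf{Additive}(S)$ costs $|S|$, every other query costs $1$, and internal randomness is free. **Statement.** (Pair) There are constants $C,k$ and a randomized algorithm EstimateAverageDegree, with inputs $n$ and $\varepsilon\in(0,1)$ and using $\mathbf{RandVert}$, $\mathbf{RandNbr}$, $\mathbf{RandEdge}$, $\mathbf{Degree}$ and $\mathbf{Pair}$, such that for every $\varepsilon\in(0,1)$ and every $G$ as above, with probability $>0.99$ its output $\widehat d$ satisfies $|\widehat d-d|\le \varepsilon d$ and the total cost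 of its queries is at most $C\,\varepsilon^{-2}(\log n)^k\,(n/d)^{1/3}$ (that is, $\widetilde O(\varepsilon^{-2}(n/d)^{1/3})$). (Additive) The same holds with $\mathbf{Additive}$ in place of $\mathbf{Pair}$ and with the bound $C\,\varepsilon^{-2}(\log n)^k\,(n/d)^{1/4}$ (that is, $\widetilde O(\varepsilon^{-2}(n/d)^{1/4})$). -/

import Mathlib

open scoped ENNReal

namespace SublinearGraph

/-- The structural oracle that is available on top of random vertices, random neighbors,
degrees and random edges: either pair queries or additive queries. -/
inductive Access where
  | pair
  | additive

/-- The queries an algorithm may ask. Vertices are referred to by their identifiers, which are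
natural numbers. Pair queries exist only under `Access.pair`, additive queries only under
`Access.additive`. -/
inductive Query : Access → Type where
  | randVert {M : Access} : Query M
  | randNbr {M : Access} (x : ℕ) : Query M
  | degree {M : Access} (x : ℕ) : Query M
  | randEdge {M : Access} : Query M
  | pair (x y : ℕ) : Query Access.pair
  | additive (S : Finset ℕ) : Query Access.additive

/-- The type of the answer to a query. -/
def Query.Answer {M : Access} : Query M → Type
  | .randVert => ℕ
  | .randNbr _ => ℕ
  | .degree _ => ℕ
  | .randEdge => Sym2 ℕ
  | .pair _ _ => Bool
  | .additive _ => ℕ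

/-- Every query has unit cost, except that `additive S` costs `|S|`. -/
def Query.cost {M : Access} : Query M → ℕ
  | .additive S => S.card
  | _ => 1

/-- A randomized adaptive query algorithm (a randomized decision tree) with output in `α`:
it stops with an output, or draws internal randomness (free of charge), or asks a query and
continues depending on the answer. -/
inductive Algorithm (M : Access) (α : Type) : Type where
  | output (a : α) : Algorithm M α
  | sample (μ : PMF ℕ) (next : ℕ → Algorithm M α) : Algorithm M α
  | ask (q : Query M) (next : q.Answer → Algorithm M α) : Algorithm M α

section Semantics

/-- The uniform distribution on `s`; on the empty set, the point mass at the default `b`. -/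
noncomputable def uniformOr {β : Type} (s : Finset β) (b : β) : PMF β :=
  if h : s.Nonempty then PMF.uniformOfFinset s h else PMF.pure b

variable {V : Type*} [Fintype V] [DecidableEq V] (G : SimpleGraph V) [DecidableRel G.Adj]
  (ident : V ↪ ℕ)

/-- The distribution of the answer to a query on the graph `G` whose vertex `v` has identifier
`ident v`. A number `x` that is not the identifier of a vertex gets uninformative answers:
it is treated like an isolated vertex, and `randNbr x` returns `x` itself. -/
noncomputable def answer {M : Access} : (q : Query M) → PMF q.Answer
  | .randVert => uniformOr (Finset.univ.map ident) (0 : ℕ)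
  | .randNbr x =>
      match Function.partialInv ident x with
      | some v => uniformOr ((G.neighborFinset v).map ident) x
      | none => PMF.pure x
  | .degree x =>
      match Function.partialInv ident x with
      | some v => PMF.pure (G.degree v)
      | none => PMF.pure (0 : ℕ)
  | .randEdge => uniformOr (G.edgeFinset.map ident.sym2Map) s(0, 0)
  | .pair x y => PMF.pure (decide (∃ u v : V, ident u = x ∧ ident v = y ∧ G.Adj u v))
  | .additive S => PMF.pure ((G.edgeFinset.filter fun e => ∀ v ∈ e, ident v ∈ S).card : ℕ)

/-- The joint distribution of the output of an algorithm and of the total cost of the queries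
it asks, on the graph `G`. All answers are drawn with fresh independent randomness. -/
noncomputable def run {M : Access} {α : Type} : Algorithm M α → PMF (α × ℕ)
  | .output a => PMF.pure (a, 0)
  | .sample μ next => μ.bind fun i => run (next i)
  | .ask q next => (answer G ident q).bind fun a =>
      (run (next a)).map fun o => (o.1, q.cost + o.2)

/-- The average degree `2 m / n`. -/
noncomputable def avgDegree : ℝ :=
  2 * (G.edgeFinset.card : ℝ) / (Fintype.card V : ℝ)

end Semantics

end SublinearGraph

namespace SublinearGraph

open scoped NNReal

set_option linter.unusedSectionVars false

/-! Let `D` be the sum of the degrees, so `d = D / n`, and let `g = n / 2 ^ i` be a guess with `d ≤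
g`. Put `r ≈ (2 ^ i) ^ (1 / p)`, with `p = 3` for pair queries and `p = 4` for additive queries, and
call a vertex heavy if its degree exceeds `t ≈ g * r`. Let `H` count the ordered adjacent pairs of
heavy vertices. Three quantities are estimated.

The fraction `h = H / D` is read off random edges. The light part `(D - H) / n = d * (1 - h)` is the
mean of a variable bounded by `2 * t`, namely the truncated degree of a random vertex, doubled when
a random neighbor is heavy. Since `t ≤ g * r`, about `r / e ^ 2` samples give additive error `e *
g`. If `h` is not close to `1`, dividing by `1 - h` recovers `d`.

If `h` is bounded below, `d` comes from a collision-type statistic. Random endpoints of random edges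
are distributed proportionally to the degree, so weighting adjacent heavy pairs by the inverse
product of the degrees gives mean `μ = H / D ^ 2 = h / (n * d)`, hence `d = h / (n * μ)`. Each
weight is at most `1 / (t + 1) ^ 2`, so `N` independent pairs have relative variance `O(1)` once `D
≤ (t + 1) ^ 2 * N`. Pair queries examine `N = r` pairs for cost `O(r)`. Additive queries examine all
`N = r ^ 2` pairs between two samples of size `r` for cost `O(r)` up to logarithms: the weights are
rounded at random to integers, split into binary digits, and each pair of digit layers is counted
with four queries. Both exponents follow from balancing `t`, `r` and `N` in `le_threshold_sq`.

No guess is known beforehand, so `Algorithm.search` halves `g` from `n` until the estimate is at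
least `g / 4`. Accurate estimates prevent stopping while `g` is far above `d` and force stopping
before `g` drops below `d` (`Algorithm.expect_search_le`). Chebyshev's inequality, with
logarithmically many extra repetitions, pays for the union bound over the guesses. -/

/-- The expectation of a nonnegative function. -/
noncomputable def expect {α : Type} (p : PMF α) (φ : α → ℝ≥0∞) : ℝ≥0∞ := ∑' x, p x * φ x

/-! ### Expectations over discrete distributions, valued in `ℝ≥0∞` -/

section Expect

variable {α β : Type}

theorem expect_pure (a : α) (φ : α → ℝ≥0∞) : expect (PMF.pure a) φ = φ a := by
  classical
  unfold expect
  rw [tsum_eq_single a]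
  · simp
  · intro b hb
    simp [PMF.pure_apply, hb]

theorem expect_bind (p : PMF α) (q : α → PMF β) (φ : β → ℝ≥0∞) :
    expect (p.bind q) φ = expect p fun x => expect (q x) φ := by
  unfold expect
  simp only [PMF.bind_apply, ← ENNReal.tsum_mul_right, ← ENNReal.tsum_mul_left]
  rw [ENNReal.tsum_comm]
  simp only [mul_assoc]

theorem expect_map (p : PMF α) (f : α → β) (φ : β → ℝ≥0∞) :
    expect (p.map f) φ = expect p fun x => φ (f x) := by
  rw [← PMF.bind_pure_comp, expect_bind]
  simp [expect_pure]

theorem expect_mono_of_support {p : PMF α} {φ ψ : α → ℝ≥0∞}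
    (h : ∀ x ∈ p.support, φ x ≤ ψ x) : expect p φ ≤ expect p ψ := by
  refine ENNReal.tsum_le_tsum fun x => ?_
  by_cases hx : p x = 0
  · simp [hx]
  · exact mul_le_mul_right (h x ((PMF.mem_support_iff p x).2 hx)) _

theorem expect_const (p : PMF α) (c : ℝ≥0∞) : expect p (fun _ => c) = c := by
  unfold expect
  rw [ENNReal.tsum_mul_right, p.tsum_coe, one_mul]

theorem expect_add (p : PMF α) (φ ψ : α → ℝ≥0∞) :
    expect p (fun x => φ x + ψ x) = expect p φ + expect p ψ := by
  unfold expect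
  simp only [mul_add, ENNReal.tsum_add]

theorem expect_const_mul (p : PMF α) (c : ℝ≥0∞) (φ : α → ℝ≥0∞) :
    expect p (fun x => c * φ x) = c * expect p φ := by
  unfold expect
  rw [← ENNReal.tsum_mul_left]
  exact tsum_congr fun x => by ring

theorem expect_comm (p : PMF α) (q : PMF β) (φ : α → β → ℝ≥0∞) :
    (expect p fun x => expect q (φ x)) = expect q fun y => expect p fun x => φ x y := by
  unfold expect
  simp only [← ENNReal.tsum_mul_left]
  rw [ENNReal.tsum_comm]
  exact tsum_congr fun y => tsum_congr fun x => by ring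

theorem expect_uniformOr {s : Finset α} (hs : s.Nonempty) (b : α) (φ : α → ℝ≥0∞) :
    expect (uniformOr s b) φ = (s.card : ℝ≥0∞)⁻¹ * ∑ x ∈ s, φ x := by
  classical
  unfold expect uniformOr
  rw [dif_pos hs, tsum_eq_sum (s := s)]
  · rw [Finset.mul_sum]
    refine Finset.sum_congr rfl fun x hx => ?_
    rw [PMF.uniformOfFinset_apply_of_mem hs hx]
  · intro x hx
    rw [PMF.uniformOfFinset_apply_of_notMem hs hx, zero_mul]

/-- Failure probabilities are handled as expectations of indicators, which compose along `bind`;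
this converts the final bound back into a success probability. -/
theorem toOuterMeasure_add_expect_not (p : PMF α) (S : Set α) [DecidablePred (· ∈ S)] :
    p.toOuterMeasure S + expect p (fun x => if x ∈ S then 0 else 1) = 1 := by
  rw [PMF.toOuterMeasure_apply, expect, ← ENNReal.tsum_add, ← p.tsum_coe]
  refine tsum_congr fun x => ?_
  by_cases hx : x ∈ S <;> simp [hx]

end Expect

/-! ### Composition, worst-case cost and independent repetition -/

namespace Algorithm

variable {M : Access} {α β γ : Type}

/-- Sequential composition. -/
def bind : Algorithm M α → (α → Algorithm M β) → Algorithm M β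
  | .output a, f => f a
  | .sample μ next, f => .sample μ fun i => (next i).bind f
  | .ask q next, f => .ask q fun a => (next a).bind f

/-- On every execution path, whatever the answers, the cost is at most `c` and the output
satisfies `P`. -/
def Within : Algorithm M α → ℕ → (α → Prop) → Prop
  | .output a, _, P => P a
  | .sample _ next, c, P => ∀ i, (next i).Within c P
  | .ask q next, c, P => q.cost ≤ c ∧ ∀ a, (next a).Within (c - q.cost) P

theorem Within.mono {A : Algorithm M α} {c c' : ℕ} {P P' : α → Prop} (h : A.Within c P)
    (hc : c ≤ c') (hP : ∀ a, P a → P' a) : A.Within c' P' := by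
  induction A generalizing c c' with
  | output a => exact hP a h
  | sample μ next ih => exact fun i => ih i (h i) hc
  | ask q next ih => exact ⟨h.1.trans hc, fun a => ih a (h.2 a) (by omega)⟩

theorem Within.bind {A : Algorithm M α} {f : α → Algorithm M β} {c c' : ℕ} {P : α → Prop}
    {Q : β → Prop} (h : A.Within c P) (hf : ∀ a, P a → (f a).Within c' Q) :
    (A.bind f).Within (c + c') Q := by
  induction A generalizing c with
  | output a => exact (hf a h).mono (by omega) fun _ => id
  | sample μ next ih => exact fun i => ih i (h i)
  | ask q next ih =>
    have := h.1
    exact ⟨by omega, fun a => (ih a (h.2 a)).mono (by omega) fun _ => id⟩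

/-- The list of the outputs of `r` independent executions. -/
def replicate (A : Algorithm M α) : ℕ → Algorithm M (List α)
  | 0 => .output []
  | r + 1 => A.bind fun a => (A.replicate r).bind fun l => .output (a :: l)

theorem Within.replicate {A : Algorithm M α} {c : ℕ} {P : α → Prop} (h : A.Within c P) (r : ℕ) :
    (A.replicate r).Within (r * c) fun l => l.length = r ∧ ∀ a ∈ l, P a := by
  induction r with
  | zero => exact ⟨rfl, by simp⟩
  | succ r ih =>
    refine Within.mono (c := c + (r * c + 0))
      (P := fun l : List α => l.length = r + 1 ∧ ∀ a ∈ l, P a)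
      (h.bind fun a ha => ih.bind fun l hl => ?_) (by linarith) fun _ => id
    refine ⟨by simp [hl.1], ?_⟩
    intro b hb
    rcases List.mem_cons.1 hb with rfl | hb
    exacts [ha, hl.2 b hb]

section Mean

variable {V : Type*} [Fintype V] [DecidableEq V] (G : SimpleGraph V) [DecidableRel G.Adj]
  (ident : V ↪ ℕ)

theorem expect_run_bind (A : Algorithm M α) (f : α → Algorithm M β) (φ : β × ℕ → ℝ≥0∞) :
    expect (run G ident (A.bind f)) φ = expect (run G ident A) fun o =>
      expect (run G ident (f o.1)) fun o' => φ (o'.1, o.2 + o'.2) := by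
  induction A generalizing φ with
  | output a => simp [bind, run, expect_pure]
  | sample μ next ih =>
    simp only [bind, run, expect_bind]
    congr 1
    funext i
    exact ih i φ
  | ask q next ih =>
    simp only [bind, run, expect_bind, expect_map]
    congr 1
    funext a
    rw [ih a]
    simp only [add_assoc]

/-- `Within` ranges over all conceivable answers and does not mention the graph; this transfers its
deterministic bounds to the actual runs. -/
theorem Within.of_mem_support {A : Algorithm M α} {c : ℕ} {P : α → Prop} (h : A.Within c P)
    {o : α × ℕ} (ho : o ∈ (run G ident A).support) : P o.1 ∧ o.2 ≤ c := by
  induction A generalizing c o with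
  | output a =>
    simp only [run, PMF.support_pure, Set.mem_singleton_iff] at ho
    subst ho
    exact ⟨h, Nat.zero_le _⟩
  | sample μ next ih =>
    simp only [run, PMF.mem_support_bind_iff] at ho
    obtain ⟨i, -, hi⟩ := ho
    exact ih i (h i) hi
  | ask q next ih =>
    simp only [run, PMF.mem_support_bind_iff, PMF.mem_support_map_iff] at ho
    obtain ⟨a, -, o', ho', rfl⟩ := ho
    have h1 := ih a (h.2 a) ho'
    have := h.1
    exact ⟨h1.1, by simp only; omega⟩

/-- The expectation of a function of the output. -/
noncomputable def mean (A : Algorithm M α) (φ : α → ℝ≥0∞) : ℝ≥0∞ :=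
  expect (run G ident A) fun o => φ o.1

theorem mean_output (a : α) (φ : α → ℝ≥0∞) :
    mean G ident (.output a : Algorithm M α) φ = φ a := by
  simp [mean, run, expect_pure]

theorem mean_sample (μ : PMF ℕ) (next : ℕ → Algorithm M α) (φ : α → ℝ≥0∞) :
    mean G ident (.sample μ next) φ = expect μ fun i => mean G ident (next i) φ := by
  simp [mean, run, expect_bind]

theorem mean_ask (q : Query M) (next : q.Answer → Algorithm M α) (φ : α → ℝ≥0∞) :
    mean G ident (.ask q next) φ =
      expect (answer G ident q) fun a => mean G ident (next a) φ := by
  simp [mean, run, expect_bind, expect_map]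

theorem mean_bind (A : Algorithm M α) (f : α → Algorithm M β) (φ : β → ℝ≥0∞) :
    mean G ident (A.bind f) φ = mean G ident A fun a => mean G ident (f a) φ :=
  expect_run_bind G ident A f fun o => φ o.1

theorem mean_add (A : Algorithm M α) (φ ψ : α → ℝ≥0∞) :
    mean G ident A (fun x => φ x + ψ x) = mean G ident A φ + mean G ident A ψ :=
  expect_add _ _ _

theorem mean_const (A : Algorithm M α) (c : ℝ≥0∞) : mean G ident A (fun _ => c) = c :=
  expect_const _ _

theorem mean_const_mul (A : Algorithm M α) (c : ℝ≥0∞) (φ : α → ℝ≥0∞) :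
    mean G ident A (fun x => c * φ x) = c * mean G ident A φ :=
  expect_const_mul _ _ _

theorem mean_mono (A : Algorithm M α) {φ ψ : α → ℝ≥0∞} (h : ∀ x, φ x ≤ ψ x) :
    mean G ident A φ ≤ mean G ident A ψ :=
  expect_mono_of_support fun x _ => h x.1

theorem mean_comm (A : Algorithm M α) (B : Algorithm M β) (φ : α → β → ℝ≥0∞) :
    (mean G ident A fun x => mean G ident B (φ x)) =
      mean G ident B fun y => mean G ident A fun x => φ x y :=
  expect_comm (run G ident A) (run G ident B) fun x y => φ x.1 y.1

variable {G ident} in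
theorem Within.mean_mono {A : Algorithm M α} {c : ℕ} {P : α → Prop} (h : A.Within c P)
    {φ ψ : α → ℝ≥0∞} (hφ : ∀ x, P x → φ x ≤ ψ x) : mean G ident A φ ≤ mean G ident A ψ :=
  expect_mono_of_support fun _ ho => hφ _ (h.of_mem_support G ident ho).1

variable {G ident} in
theorem Within.mean_congr {A : Algorithm M α} {c : ℕ} {P : α → Prop} (h : A.Within c P)
    {φ ψ : α → ℝ≥0∞} (hφ : ∀ x, P x → φ x = ψ x) : mean G ident A φ = mean G ident A ψ :=
  le_antisymm (h.mean_mono fun x hx => (hφ x hx).le) (h.mean_mono fun x hx => (hφ x hx).ge)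

theorem mean_replicate_sum (A : Algorithm M α) (φ : α → ℝ≥0∞) (r : ℕ) :
    mean G ident (A.replicate r) (fun l => (l.map φ).sum) = r * mean G ident A φ := by
  induction r with
  | zero => simp [replicate, mean_output]
  | succ r ih =>
    simp only [replicate, mean_bind, mean_output, List.map_cons, List.sum_cons, mean_add,
      mean_const, ih]
    push_cast
    ring

/-- Independence makes the cross terms products of means. There are `r * (r - 1)` of them; rounding
up to `r ^ 2` avoids a subtraction in `ℝ≥0∞`. -/
theorem mean_replicate_sum_sq_le (A : Algorithm M α) (φ : α → ℝ≥0∞) (r : ℕ) :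
    mean G ident (A.replicate r) (fun l => (l.map φ).sum ^ 2) ≤
      r * mean G ident A (fun a => φ a ^ 2) + r ^ 2 * mean G ident A φ ^ 2 := by
  induction r with
  | zero => simp [replicate, mean_output]
  | succ r ih =>
    have h1 : ∀ x : α, ∀ l : List α, (φ x + (l.map φ).sum) ^ 2 =
        φ x ^ 2 + 2 * φ x * (l.map φ).sum + (l.map φ).sum ^ 2 := fun x l => by ring
    have h2 : ∀ x : α, 2 * φ x * (r * mean G ident A φ) = (2 * (r * mean G ident A φ)) * φ x :=
      fun x => by ring
    simp only [replicate, mean_bind, mean_output, List.map_cons, List.sum_cons, h1, mean_add,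
      mean_const, mean_const_mul, mean_replicate_sum, h2]
    calc _ ≤ mean G ident A (fun a => φ a ^ 2) + 2 * (r * mean G ident A φ) * mean G ident A φ +
          (r * mean G ident A (fun a => φ a ^ 2) + r ^ 2 * mean G ident A φ ^ 2) := by gcongr
      _ ≤ _ + mean G ident A φ ^ 2 := le_self_add
      _ = _ := by push_cast; ring

/-- Chebyshev's inequality for the empirical mean. -/
theorem mean_replicate_deviation_le (A : Algorithm M ℝ≥0) {μ q x : ℝ} (r : ℕ)
    (hμ : 0 ≤ μ) (_hq : 0 ≤ q) (hr : 0 < r) (hx : 0 < x)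
    (h1 : mean G ident A (fun a => (a : ℝ≥0∞)) = ENNReal.ofReal μ)
    (h2 : mean G ident A (fun a => (a : ℝ≥0∞) ^ 2) ≤ ENNReal.ofReal q) :
    mean G ident (A.replicate r)
      (fun l => if |(l.sum : ℝ) / r - μ| ≤ x then 0 else 1) ≤ ENNReal.ofReal (q / (r * x ^ 2)) := by
  set dev : List ℝ≥0 → ℝ≥0∞ := fun l => ENNReal.ofReal (((l.sum : ℝ) - r * μ) ^ 2) with hdev
  set S : List ℝ≥0 → ℝ≥0∞ := fun l => (l.map (fun a : ℝ≥0 => (a : ℝ≥0∞))).sum with hS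
  have hSsum : ∀ l, S l = ENNReal.ofReal (l.sum : ℝ) := by
    intro l
    rw [ENNReal.ofReal_coe_nnreal]
    induction l with
    | nil => simp [hS]
    | cons a l ih => simp only [hS, List.map_cons, List.sum_cons, ENNReal.coe_add] at ih ⊢; rw [ih]
  have hr0 : (0 : ℝ) < r := by exact_mod_cast hr
  -- The expanded square with its negative cross term moved to the left, since subtraction in `ℝ≥0∞`
  -- truncates.
  have key : ∀ l, dev l + ENNReal.ofReal (2 * (r * μ)) * S l =
      S l ^ 2 + ENNReal.ofReal ((r * μ) ^ 2) := by
    intro l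
    have hl : (0 : ℝ) ≤ (l.sum : ℝ) := NNReal.coe_nonneg _
    rw [hSsum, hdev, ← ENNReal.ofReal_mul (by positivity), ← ENNReal.ofReal_pow hl,
      ← ENNReal.ofReal_add (by positivity) (by positivity),
      ← ENNReal.ofReal_add (by positivity) (by positivity)]
    congr 1
    ring
  have hmeanS : mean G ident (A.replicate r) S = ENNReal.ofReal (r * μ) := by
    rw [mean_replicate_sum, h1, ENNReal.ofReal_mul hr0.le, ENNReal.ofReal_natCast]
  have hsq : mean G ident (A.replicate r) (fun l => S l ^ 2) ≤
      ENNReal.ofReal (r * q) + ENNReal.ofReal ((r * μ) ^ 2) := by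
    refine (mean_replicate_sum_sq_le G ident A _ r).trans ?_
    rw [h1, ENNReal.ofReal_mul hr0.le, ENNReal.ofReal_natCast, mul_pow,
      ENNReal.ofReal_mul (by positivity), ENNReal.ofReal_pow hr0.le, ENNReal.ofReal_natCast,
      ENNReal.ofReal_pow hμ]
    gcongr
  have hdevle : mean G ident (A.replicate r) dev ≤ ENNReal.ofReal (r * q) := by
    have h3 : mean G ident (A.replicate r) dev + ENNReal.ofReal (2 * (r * μ) ^ 2) =
        mean G ident (A.replicate r) (fun l => S l ^ 2) + ENNReal.ofReal ((r * μ) ^ 2) := by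
      have := congrArg (mean G ident (A.replicate r)) (funext key)
      rw [mean_add, mean_add, mean_const, mean_const_mul, hmeanS,
        ← ENNReal.ofReal_mul (by positivity)] at this
      rw [← this]
      congr 2
      ring
    have h4 : mean G ident (A.replicate r) dev + ENNReal.ofReal (2 * (r * μ) ^ 2) ≤
        ENNReal.ofReal (r * q) + ENNReal.ofReal (2 * (r * μ) ^ 2) := by
      rw [h3]
      refine (add_le_add_left hsq _).trans_eq ?_
      rw [add_assoc, ← ENNReal.ofReal_add (by positivity) (by positivity)]
      congr 2
      ring
    exact (ENNReal.add_le_add_iff_right ENNReal.ofReal_ne_top).1 h4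
  have hpt : ∀ l : List ℝ≥0, (if |(l.sum : ℝ) / r - μ| ≤ x then (0 : ℝ≥0∞) else 1) ≤
      ENNReal.ofReal (((r : ℝ) * x) ^ 2)⁻¹ * dev l := by
    intro l
    split_ifs with h
    · exact zero_le
    · rw [← ENNReal.ofReal_mul (by positivity), ← ENNReal.ofReal_one]
      refine ENNReal.ofReal_le_ofReal ?_
      have h5 : ((l.sum : ℝ) - r * μ) = r * ((l.sum : ℝ) / r - μ) := by field_simp
      rw [h5, inv_mul_eq_div, one_le_div (by positivity), mul_pow, mul_pow,
        ← sq_abs ((l.sum : ℝ) / r - μ)]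
      have := (not_le.1 h).le
      gcongr
  calc _ ≤ _ := mean_mono G ident _ hpt
    _ ≤ ENNReal.ofReal (((r : ℝ) * x) ^ 2)⁻¹ * ENNReal.ofReal (r * q) := by
        rw [mean_const_mul]; gcongr
    _ = _ := by
        rw [← ENNReal.ofReal_mul (by positivity)]
        congr 1
        field_simp

end Mean

end Algorithm

/-! ### Sums over adjacent pairs and the heavy part of the degree sum -/

section Graph

variable {V : Type*} [Fintype V] [DecidableEq V] (G : SimpleGraph V) [DecidableRel G.Adj]
  (ident : V ↪ ℕ)

theorem sum_neighbor_comm {R : Type*} [AddCommMonoid R] (F : V → V → R) :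
    ∑ u, ∑ v ∈ G.neighborFinset u, F u v = ∑ u, ∑ v ∈ G.neighborFinset u, F v u := by
  refine Finset.sum_comm' fun u v => ?_
  simp [G.adj_comm]

theorem sum_neighbor_edge {R : Type*} [AddCommMonoid R] (F : Sym2 V → R) :
    ∑ u, ∑ v ∈ G.neighborFinset u, F s(u, v) = 2 • ∑ e ∈ G.edgeFinset, F e := by
  have h1 : ∑ u, ∑ v ∈ G.neighborFinset u, F s(u, v) = ∑ d : G.Dart, F d.edge := by
    rw [Finset.sum_sigma']
    refine Finset.sum_bij' (fun p hp => ⟨(p.1, p.2), by simpa using hp⟩)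
      (fun d _ => ⟨d.fst, d.snd⟩) ?_ ?_ ?_ ?_ ?_
    · simp
    · simp [SimpleGraph.Dart.adj]
    · simp
    · simp
    · simp [SimpleGraph.Dart.edge]
  rw [h1, ← Finset.sum_fiberwise_of_maps_to (s := Finset.univ) (t := G.edgeFinset)
    (g := fun d : G.Dart => d.edge) (by simp [SimpleGraph.Dart.edge_mem]), ← Finset.sum_nsmul]
  refine Finset.sum_congr rfl fun e he => ?_
  rw [Finset.sum_congr rfl (g := fun _ => F e) (by simp +contextual), Finset.sum_const,
    G.dart_edge_fiber_card e (by simpa using he)]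

/-- The sum of the degrees. -/
def totalDegree : ℕ := ∑ v, G.degree v

/-- The number of neighbors of `u` of degree above `t`. -/
def heavyDegree (t : ℕ) (u : V) : ℕ := ((G.neighborFinset u).filter fun v => t < G.degree v).card

/-- The number of ordered adjacent pairs of vertices of degree above `t`. -/
def heavyPairs (t : ℕ) : ℕ := ∑ u, if t < G.degree u then heavyDegree G t u else 0

theorem totalDegree_eq : totalDegree G = 2 * G.edgeFinset.card :=
  G.sum_degrees_eq_twice_card_edges

theorem heavyDegree_le (t : ℕ) (u : V) : heavyDegree G t u ≤ G.degree u :=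
  Finset.card_filter_le _ _

theorem heavyPairs_le (t : ℕ) : heavyPairs G t ≤ totalDegree G := by
  refine Finset.sum_le_sum fun u _ => ?_
  split_ifs
  exacts [heavyDegree_le G t u, Nat.zero_le _]

theorem heavyPairs_eq_sum (t : ℕ) : (heavyPairs G t : ℝ≥0∞) =
    ∑ u, ∑ v ∈ G.neighborFinset u, if t < G.degree u ∧ t < G.degree v then 1 else 0 := by
  unfold heavyPairs heavyDegree
  push_cast
  refine Finset.sum_congr rfl fun u _ => ?_
  by_cases hu : t < G.degree u <;> simp [hu]

section Nonempty

variable {G}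

theorem edgeFinset_nonempty [Nonempty V] (hdeg : ∀ v, 1 ≤ G.degree v) : G.edgeFinset.Nonempty := by
  obtain ⟨v⟩ := ‹Nonempty V›
  obtain ⟨w, hw⟩ := (G.degree_pos_iff_exists_adj v).1 (hdeg v)
  exact ⟨s(v, w), by simpa using hw⟩

theorem card_le_totalDegree (hdeg : ∀ v, 1 ≤ G.degree v) : Fintype.card V ≤ totalDegree G := by
  rw [← Finset.card_univ, Finset.card_eq_sum_ones]
  exact Finset.sum_le_sum fun v _ => hdeg v

end Nonempty

theorem totalDegree_le : totalDegree G ≤ Fintype.card V ^ 2 := by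
  calc totalDegree G ≤ ∑ _v : V, Fintype.card V :=
        Finset.sum_le_sum fun v _ => (G.degree_lt_card_verts v).le
    _ = _ := by simp [sq]

end Graph

/-! ### Elementary samplers and their moments -/

namespace Algorithm

variable {M : Access} {α : Type}

/-- Ask for a random vertex. -/
def askRandVert (next : ℕ → Algorithm M α) : Algorithm M α := .ask .randVert next

/-- Ask for a random neighbor. -/
def askRandNbr (x : ℕ) (next : ℕ → Algorithm M α) : Algorithm M α := .ask (.randNbr x) next

/-- Ask for a degree. -/
def askDegree (x : ℕ) (next : ℕ → Algorithm M α) : Algorithm M α := .ask (.degree x) next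

/-- Ask for a random edge. -/
def askRandEdge (next : Sym2 ℕ → Algorithm M α) : Algorithm M α := .ask .randEdge next

section Within

variable {c : ℕ} {P : α → Prop}

theorem Within.askRandVert {next : ℕ → Algorithm M α} (h : ∀ a, (next a).Within c P) :
    (askRandVert next).Within (1 + c) P :=
  ⟨Nat.le_add_right _ _, fun a => (h a).mono (by simp [Query.cost]) fun _ => id⟩

theorem Within.askRandNbr {x : ℕ} {next : ℕ → Algorithm M α} (h : ∀ a, (next a).Within c P) :
    (askRandNbr x next).Within (1 + c) P :=
  ⟨Nat.le_add_right _ _, fun a => (h a).mono (by simp [Query.cost]) fun _ => id⟩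

theorem Within.askDegree {x : ℕ} {next : ℕ → Algorithm M α} (h : ∀ a, (next a).Within c P) :
    (askDegree x next).Within (1 + c) P :=
  ⟨Nat.le_add_right _ _, fun a => (h a).mono (by simp [Query.cost]) fun _ => id⟩

theorem Within.askRandEdge {next : Sym2 ℕ → Algorithm M α} (h : ∀ a, (next a).Within c P) :
    (askRandEdge next).Within (1 + c) P :=
  ⟨Nat.le_add_right _ _, fun a => (h a).mono (by simp [Query.cost]) fun _ => id⟩

theorem Within.sample {μ : PMF ℕ} {next : ℕ → Algorithm M α} (h : ∀ a, (next a).Within c P) :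
    (Algorithm.sample μ next).Within c P :=
  h

theorem Within.output {a : α} (h : P a) : (Algorithm.output a : Algorithm M α).Within c P :=
  h

end Within

/-- A random endpoint of a random edge. -/
noncomputable def endpoint : Algorithm M ℕ :=
  askRandEdge fun e : Sym2 ℕ => .sample (uniformOr {0, 1} 0) fun b =>
    .output (if b = 0 then e.inf else e.sup)

/-- Whether both endpoints of a random edge have degree above `t`. -/
noncomputable def heavyEdge (t : ℕ) : Algorithm M ℝ≥0 :=
  askRandEdge fun e : Sym2 ℕ => askDegree e.inf fun a : ℕ =>
    askDegree e.sup fun b : ℕ => .output (if t < a ∧ t < b then 1 else 0)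

/-- The degree of a random vertex, replaced by zero if it is above `t`, and doubled if it is at
most `t` but that of a random neighbor is above `t`. -/
noncomputable def lightDegree (t : ℕ) : Algorithm M ℝ≥0 :=
  askRandVert fun u : ℕ => askDegree u fun a : ℕ =>
    if a ≤ t then
      askRandNbr u fun v : ℕ => askDegree v fun b : ℕ =>
        .output (if t < b then 2 * (a : ℝ≥0) else a)
    else .output 0

theorem endpoint_within : (endpoint : Algorithm M ℕ).Within 1 fun _ => True :=
  .askRandEdge (c := 0) fun _ => .sample fun _ => .output trivial

theorem heavyEdge_within (t : ℕ) :
    (heavyEdge t : Algorithm M ℝ≥0).Within 3 fun x => x ≤ 1 := by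
  refine .askRandEdge (c := 2) fun e => .askDegree (c := 1) fun a => .askDegree (c := 0) fun b =>
    .output ?_
  split_ifs <;> simp

theorem lightDegree_within (t : ℕ) :
    (lightDegree t : Algorithm M ℝ≥0).Within 4 fun x => x ≤ 2 * t := by
  refine .askRandVert (c := 3) fun u => .askDegree (c := 2) fun a => ?_
  split_ifs with ha
  · have ha' : (a : ℝ≥0) ≤ t := by exact_mod_cast ha
    refine .askRandNbr (c := 1) fun v => .askDegree (c := 0) fun b => .output ?_
    split_ifs
    · gcongr
    · exact ha'.trans (le_mul_of_one_le_left zero_le one_le_two)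
  · exact .output zero_le

section Mean

variable {V : Type*} [Fintype V] [DecidableEq V] {G : SimpleGraph V} [DecidableRel G.Adj]
  {ident : V ↪ ℕ}

theorem mean_ask_degree (v : V) (next : ℕ → Algorithm M α) (φ : α → ℝ≥0∞) :
    mean G ident (askDegree (ident v) next) φ = mean G ident (next (G.degree v)) φ := by
  have : answer G ident (.degree (ident v) : Query M) = PMF.pure (G.degree v) := by
    simp only [answer, Function.partialInv_left ident.injective v]
    rfl
  refine (mean_ask (M := M) G ident (.degree (ident v)) next φ).trans ?_
  rw [this]
  exact expect_pure (G.degree v) fun a => mean G ident (next a) φ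

theorem mean_ask_randVert [Nonempty V] (next : ℕ → Algorithm M α) (φ : α → ℝ≥0∞) :
    mean G ident (askRandVert next) φ =
      (Fintype.card V : ℝ≥0∞)⁻¹ * ∑ v, mean G ident (next (ident v)) φ := by
  refine (mean_ask (M := M) G ident .randVert next φ).trans ?_
  refine (expect_uniformOr (s := Finset.univ.map ident) (by simp) 0 _).trans ?_
  rw [Finset.card_map, Finset.sum_map, Finset.card_univ]

theorem mean_ask_randNbr (hdeg : ∀ v, 1 ≤ G.degree v) (v : V) (next : ℕ → Algorithm M α)
    (φ : α → ℝ≥0∞) :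
    mean G ident (askRandNbr (ident v) next) φ =
      (G.degree v : ℝ≥0∞)⁻¹ * ∑ w ∈ G.neighborFinset v, mean G ident (next (ident w)) φ := by
  have : answer G ident (.randNbr (ident v) : Query M) =
      uniformOr ((G.neighborFinset v).map ident) (ident v) := by
    simp only [answer, Function.partialInv_left ident.injective v]
    rfl
  refine (mean_ask (M := M) G ident (.randNbr (ident v)) next φ).trans ?_
  rw [this]
  refine (expect_uniformOr (s := (G.neighborFinset v).map ident) ?_ (ident v) _).trans ?_
  · rw [Finset.map_nonempty, ← Finset.card_pos, G.card_neighborFinset_eq_degree]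
    exact hdeg v
  · rw [Finset.card_map, Finset.sum_map, G.card_neighborFinset_eq_degree]

theorem mean_ask_randEdge [Nonempty V] (hdeg : ∀ v, 1 ≤ G.degree v)
    (next : Sym2 ℕ → Algorithm M α) (φ : α → ℝ≥0∞) :
    mean G ident (askRandEdge next) φ =
      (totalDegree G : ℝ≥0∞)⁻¹ * ∑ u, ∑ v ∈ G.neighborFinset u,
        mean G ident (next s(ident u, ident v)) φ := by
  refine (mean_ask (M := M) G ident .randEdge next φ).trans ?_
  refine (expect_uniformOr (s := G.edgeFinset.map ident.sym2Map)
    (by simpa using edgeFinset_nonempty hdeg) s(0, 0) _).trans ?_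
  rw [Finset.card_map, Finset.sum_map, totalDegree_eq]
  have := sum_neighbor_edge G fun e => mean G ident (next (ident.sym2Map e)) φ
  simp only [Function.Embedding.sym2Map_apply, Sym2.map_mk] at this ⊢
  rw [this, nsmul_eq_mul, ← mul_assoc]
  push_cast
  rw [ENNReal.mul_inv (by simp) (by simp), mul_right_comm 2⁻¹,
    ENNReal.inv_mul_cancel (by simp) (by simp), one_mul]

/-- A vertex of degree `a` lies on `a` of the `D / 2` edges and is the chosen endpoint of each with
probability `1 / 2`, so it appears with probability `a / D`. -/
theorem mean_endpoint [Nonempty V] (hdeg : ∀ v, 1 ≤ G.degree v) (φ : ℕ → ℝ≥0∞) :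
    mean G ident (endpoint : Algorithm M ℕ) φ =
      (totalDegree G : ℝ≥0∞)⁻¹ * ∑ v, G.degree v * φ (ident v) := by
  unfold endpoint
  rw [mean_ask_randEdge hdeg]
  congr 1
  have h1 : ∀ u v : V, mean G ident (.sample (uniformOr {0, 1} 0) fun b =>
      .output (if b = 0 then s(ident u, ident v).inf else s(ident u, ident v).sup) :
        Algorithm M ℕ) φ
      = 2⁻¹ * (φ (ident u) + φ (ident v)) := by
    intro u v
    rw [mean_sample, expect_uniformOr (by simp)]
    simp only [mean_output, Sym2.inf_mk, Sym2.sup_mk]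
    rcases le_total (ident u) (ident v) with h | h
    · simp [h]
    · simp [h, add_comm]
  simp only [h1, ← Finset.mul_sum, Finset.sum_add_distrib]
  rw [sum_neighbor_comm G fun u v => φ (ident v), ← mul_two, mul_comm, mul_assoc,
    ENNReal.mul_inv_cancel (by simp) (by simp), mul_one]
  simp

theorem mean_heavyEdge [Nonempty V] (hdeg : ∀ v, 1 ≤ G.degree v) (t : ℕ) (k : ℕ) (hk : k ≠ 0) :
    mean G ident (heavyEdge t : Algorithm M ℝ≥0) (fun x => (x : ℝ≥0∞) ^ k) =
      heavyPairs G t / totalDegree G := by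
  unfold heavyEdge
  rw [mean_ask_randEdge hdeg, heavyPairs_eq_sum, ENNReal.div_eq_inv_mul]
  congr 1
  refine Finset.sum_congr rfl fun u _ => Finset.sum_congr rfl fun v _ => ?_
  rcases le_total (ident u) (ident v) with h | h
  · simp only [Sym2.inf_mk, Sym2.sup_mk, h, inf_of_le_left, sup_of_le_right, mean_ask_degree,
      mean_output]
    split_ifs <;> simp [hk]
  · simp only [Sym2.inf_mk, Sym2.sup_mk, h, inf_of_le_right, sup_of_le_left, mean_ask_degree,
      mean_output, and_comm (a := t < G.degree v)]
    split_ifs <;> simp [hk]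

/-- Light-light pairs are counted once from each end. A light-heavy pair is counted twice from its
light end, which also pays for the reversed pair. Only heavy-heavy pairs are missing; they are added
on the left to avoid subtraction. -/
theorem mean_lightDegree [Nonempty V] (hdeg : ∀ v, 1 ≤ G.degree v) (t : ℕ) :
    mean G ident (lightDegree t : Algorithm M ℝ≥0) (fun x => (x : ℝ≥0∞)) +
      heavyPairs G t / Fintype.card V = totalDegree G / Fintype.card V := by
  unfold lightDegree
  have h1 : ∀ u : V, (mean G ident (if G.degree u ≤ t then
      askRandNbr (ident u) fun v : ℕ => askDegree v fun b : ℕ =>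
        .output (if t < b then 2 * (G.degree u : ℝ≥0) else G.degree u)
      else .output 0 : Algorithm M ℝ≥0) fun x => (x : ℝ≥0∞)) =
      ∑ v ∈ G.neighborFinset u,
        (if G.degree u ≤ t then (1 + if t < G.degree v then 1 else 0 : ℝ≥0∞) else 0) := by
    intro u
    have hu : (G.degree u : ℝ≥0∞) ≠ 0 := by
      have := hdeg u
      simp only [ne_eq, Nat.cast_eq_zero]
      omega
    split_ifs
    · rw [mean_ask_randNbr hdeg, Finset.mul_sum]
      refine Finset.sum_congr rfl fun v _ => ?_
      rw [mean_ask_degree, mean_output]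
      split_ifs
      · push_cast
        rw [mul_left_comm, ENNReal.inv_mul_cancel hu (by simp), mul_one, one_add_one_eq_two]
      · push_cast
        rw [ENNReal.inv_mul_cancel hu (by simp), add_zero]
    · simp [mean_output]
  rw [mean_ask_randVert]
  simp only [mean_ask_degree, h1]
  rw [heavyPairs_eq_sum, ENNReal.div_eq_inv_mul, ENNReal.div_eq_inv_mul, ← mul_add]
  congr 1
  have h2 : (totalDegree G : ℝ≥0∞) = ∑ u, ∑ v ∈ G.neighborFinset u,
      ((if G.degree u ≤ t then (1 : ℝ≥0∞) else 0) +
        (if t < G.degree u ∧ t < G.degree v then 1 else 0)) +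
      ∑ u, ∑ v ∈ G.neighborFinset u, if t < G.degree u ∧ G.degree v ≤ t then (1 : ℝ≥0∞) else 0 := by
    simp only [← Finset.sum_add_distrib]
    unfold totalDegree
    push_cast
    refine Finset.sum_congr rfl fun u _ => ?_
    rw [Finset.sum_congr rfl (g := fun _ => (1 : ℝ≥0∞))]
    · simp
    · intro v _
      simp only [← not_le]
      by_cases hu : G.degree u ≤ t <;> by_cases hv : G.degree v ≤ t <;> simp [hu, hv]
  rw [h2, sum_neighbor_comm G fun u v => if t < G.degree u ∧ G.degree v ≤ t then (1 : ℝ≥0∞) else 0]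
  simp only [← Finset.sum_add_distrib]
  refine Finset.sum_congr rfl fun u _ => Finset.sum_congr rfl fun v _ => ?_
  simp only [← not_le]
  by_cases hu : G.degree u ≤ t <;> by_cases hv : G.degree v ≤ t <;> simp [hu, hv]

theorem mean_lightDegree_sq_le (t : ℕ) :
    mean G ident (lightDegree t : Algorithm M ℝ≥0) (fun x => (x : ℝ≥0∞) ^ 2) ≤
      2 * t * mean G ident (lightDegree t : Algorithm M ℝ≥0) (fun x => (x : ℝ≥0∞)) := by
  rw [← mean_const_mul]
  refine (lightDegree_within t).mean_mono fun x hx => ?_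
  rw [sq]
  gcongr
  exact_mod_cast hx

end Mean

end Algorithm

theorem coe_list_sum (l : List ℝ≥0) :
    ((l.sum : ℝ≥0) : ℝ≥0∞) = (l.map fun a : ℝ≥0 => (a : ℝ≥0∞)).sum := by
  induction l with
  | nil => simp
  | cons a l ih => simp only [List.sum_cons, List.map_cons, ENNReal.coe_add, ih]

theorem natCast_div_eq_ofReal (a : ℕ) {b : ℕ} (hb : 0 < b) :
    (a / b : ℝ≥0∞) = ENNReal.ofReal (a / b) := by
  rw [ENNReal.ofReal_div_of_pos (by exact_mod_cast hb), ENNReal.ofReal_natCast,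
    ENNReal.ofReal_natCast]

section Graph

variable {V : Type*} [Fintype V] [DecidableEq V] (G : SimpleGraph V) [DecidableRel G.Adj]

theorem heavyDegree_eq_sum (t : ℕ) (u : V) : (heavyDegree G t u : ℝ≥0∞) =
    ∑ v, if t < G.degree v then if G.Adj u v then 1 else 0 else 0 := by
  simp only [heavyDegree, SimpleGraph.neighborFinset_eq_filter, Finset.filter_filter,
    Finset.card_filter]
  push_cast
  refine Finset.sum_congr rfl fun v _ => ?_
  by_cases h1 : G.Adj u v <;> by_cases h2 : t < G.degree v <;> simp [h1, h2]

end Graph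

/-! ### Heavy-edge frequency from pair queries -/

namespace Algorithm

variable {M : Access} {α : Type}

/-- A random endpoint of a random edge, together with its degree. -/
noncomputable def endpointDegree : Algorithm M (ℕ × ℕ) :=
  endpoint.bind fun u => askDegree u fun a => .output (u, a)

theorem endpointDegree_within : (endpointDegree : Algorithm M (ℕ × ℕ)).Within 2 fun _ => True :=
  endpoint_within.bind (c' := 1) fun _ _ => .askDegree (c := 0) fun _ => .output trivial

/-- The average of the outputs of `r` independent executions. -/
noncomputable def average (A : Algorithm M ℝ≥0) (r : ℕ) : Algorithm M ℝ≥0 :=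
  (A.replicate r).bind fun l => .output (l.sum / r)

theorem Within.average {A : Algorithm M ℝ≥0} {c : ℕ} {P : ℝ≥0 → Prop} (h : A.Within c P) (r : ℕ) :
    (A.average r).Within (r * c) fun _ => True :=
  (h.replicate r).bind (c' := 0) fun _ _ => .output trivial

/-- Ask whether two vertices are adjacent. -/
def askPair (x y : ℕ) (next : Bool → Algorithm .pair α) : Algorithm .pair α :=
  .ask (.pair x y) next

theorem Within.askPair {c : ℕ} {P : α → Prop} {x y : ℕ} {next : Bool → Algorithm .pair α}
    (h : ∀ a, (next a).Within c P) : (askPair x y next).Within (1 + c) P :=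
  ⟨Nat.le_add_right _ _, fun a => (h a).mono (by simp [Query.cost]) fun _ => id⟩

/-- The inverse product of the degrees of two random endpoints of random edges, if they are
adjacent and of degree above `t`, and zero otherwise. -/
noncomputable def pairSample (t : ℕ) : Algorithm .pair ℝ≥0 :=
  endpointDegree.bind fun x => endpointDegree.bind fun y => askPair x.1 y.1 fun b =>
    .output (if t < x.2 ∧ t < y.2 ∧ b = true then ((x.2 : ℝ≥0) * y.2)⁻¹ else 0)

theorem pairSample_within (t : ℕ) :
    (pairSample t).Within 5 fun z => z ≤ (((t : ℝ≥0) + 1) ^ 2)⁻¹ := by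
  refine endpointDegree_within.bind (c' := 3) fun x _ => endpointDegree_within.bind (c' := 1)
    fun y _ => .askPair (c := 0) fun b => .output ?_
  split_ifs with h
  · have h1 : (t : ℝ≥0) + 1 ≤ x.2 := by exact_mod_cast h.1
    have h2 : (t : ℝ≥0) + 1 ≤ y.2 := by exact_mod_cast h.2.1
    rw [sq]
    gcongr
  · exact zero_le

section Mean

variable {V : Type*} [Fintype V] [DecidableEq V] {G : SimpleGraph V} [DecidableRel G.Adj]
  {ident : V ↪ ℕ}

theorem mean_endpointDegree [Nonempty V] (hdeg : ∀ v, 1 ≤ G.degree v) (φ : ℕ × ℕ → ℝ≥0∞) :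
    mean G ident (endpointDegree : Algorithm M (ℕ × ℕ)) φ =
      (totalDegree G : ℝ≥0∞)⁻¹ * ∑ v, G.degree v * φ (ident v, G.degree v) := by
  rw [endpointDegree, mean_bind, mean_endpoint hdeg]
  simp only [mean_ask_degree, mean_output]

theorem mean_average (A : Algorithm M ℝ≥0) {r : ℕ} (hr : 0 < r) :
    mean G ident (A.average r) (fun x => (x : ℝ≥0∞)) =
      mean G ident A fun x => (x : ℝ≥0∞) := by
  have h : ∀ l : List ℝ≥0, ((l.sum / r : ℝ≥0) : ℝ≥0∞) =
      (r : ℝ≥0∞)⁻¹ * (l.map fun a : ℝ≥0 => (a : ℝ≥0∞)).sum := by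
    intro l
    rw [ENNReal.coe_div (by positivity), coe_list_sum, ENNReal.div_eq_inv_mul]
    simp
  simp only [average, mean_bind, mean_output, h, mean_const_mul, mean_replicate_sum]
  rw [← mul_assoc, ENNReal.inv_mul_cancel (by simpa using hr.ne') (by simp), one_mul]

theorem mean_average_sq_le (A : Algorithm M ℝ≥0) {r : ℕ} (hr : 0 < r) :
    mean G ident (A.average r) (fun x => (x : ℝ≥0∞) ^ 2) ≤
      mean G ident A (fun x => (x : ℝ≥0∞) ^ 2) / r + mean G ident A (fun x => (x : ℝ≥0∞)) ^ 2 := by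
  have h : ∀ l : List ℝ≥0, ((l.sum / r : ℝ≥0) : ℝ≥0∞) ^ 2 =
      ((r : ℝ≥0∞)⁻¹) ^ 2 * (l.map fun a : ℝ≥0 => (a : ℝ≥0∞)).sum ^ 2 := by
    intro l
    rw [ENNReal.coe_div (by positivity), coe_list_sum, ENNReal.div_eq_inv_mul, mul_pow]
    simp
  simp only [average, mean_bind, mean_output, h, mean_const_mul]
  have hr1 : (r : ℝ≥0∞)⁻¹ * r = 1 := ENNReal.inv_mul_cancel (by simpa using hr.ne') (by simp)
  calc _ ≤ ((r : ℝ≥0∞)⁻¹) ^ 2 * (r * mean G ident A (fun x => (x : ℝ≥0∞) ^ 2) +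
        r ^ 2 * mean G ident A (fun x => (x : ℝ≥0∞)) ^ 2) := by
        gcongr
        exact mean_replicate_sum_sq_le G ident A (fun x : ℝ≥0 => (x : ℝ≥0∞)) r
    _ = ((r : ℝ≥0∞)⁻¹ * r) * mean G ident A (fun x => (x : ℝ≥0∞) ^ 2) * (r : ℝ≥0∞)⁻¹ +
        ((r : ℝ≥0∞)⁻¹ * r) ^ 2 * mean G ident A (fun x => (x : ℝ≥0∞)) ^ 2 := by ring
    _ = _ := by rw [hr1, one_pow, one_mul, one_mul, ENNReal.div_eq_inv_mul, mul_comm]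

theorem mean_ask_pair (u v : V) (next : Bool → Algorithm .pair α) (φ : α → ℝ≥0∞) :
    mean G ident (askPair (ident u) (ident v) next) φ =
      mean G ident (next (decide (G.Adj u v))) φ := by
  have : answer G ident (.pair (ident u) (ident v)) = PMF.pure (decide (G.Adj u v)) := by
    simp only [answer]
    simp
    rfl
  refine (mean_ask (M := .pair) G ident (.pair (ident u) (ident v)) next φ).trans ?_
  rw [this]
  exact expect_pure (decide (G.Adj u v)) fun a => mean G ident (next a) φ

/-- The pair `(u, v)` is drawn with probability `deg u * deg v / D ^ 2`, and the weight cancels the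
two degrees. -/
theorem mean_pairSample [Nonempty V] (hdeg : ∀ v, 1 ≤ G.degree v) (t : ℕ) :
    mean G ident (pairSample t) (fun x => (x : ℝ≥0∞)) =
      heavyPairs G t / (totalDegree G ^ 2 : ℕ) := by
  have hd : ∀ v : V, (G.degree v : ℝ≥0∞) ≠ 0 := fun v => by
    have := hdeg v
    simp only [ne_eq, Nat.cast_eq_zero]
    omega
  simp only [pairSample, mean_bind, mean_endpointDegree hdeg, mean_ask_pair, mean_output]
  have h1 : ∀ u v : V, (G.degree v : ℝ≥0∞) * ((if t < G.degree u ∧ t < G.degree v ∧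
      decide (G.Adj u v) = true then ((G.degree u : ℝ≥0) * G.degree v)⁻¹ else 0 : ℝ≥0) : ℝ≥0∞) =
      (G.degree u : ℝ≥0∞)⁻¹ * if t < G.degree u then if t < G.degree v then
        if G.Adj u v then 1 else 0 else 0 else 0 := by
    intro u v
    by_cases hu : t < G.degree u <;> by_cases hv : t < G.degree v <;>
      by_cases huv : G.Adj u v <;> simp [hu, hv, huv]
    have hu0 : (G.degree u : ℝ≥0) ≠ 0 := by exact_mod_cast hd u
    have hv0 : (G.degree v : ℝ≥0) ≠ 0 := by exact_mod_cast hd v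
    rw [ENNReal.coe_inv hu0, ENNReal.coe_inv hv0, ENNReal.coe_natCast, ENNReal.coe_natCast,
      ← mul_assoc,
      ENNReal.mul_inv_cancel (hd v) (by simp), one_mul]
  have h2 : ∀ u : V, (G.degree u : ℝ≥0∞) * ((totalDegree G : ℝ≥0∞)⁻¹ * ∑ v,
      (G.degree v : ℝ≥0∞) * ((if t < G.degree u ∧ t < G.degree v ∧
      decide (G.Adj u v) = true then ((G.degree u : ℝ≥0) * G.degree v)⁻¹ else 0 : ℝ≥0) : ℝ≥0∞)) =
      (totalDegree G : ℝ≥0∞)⁻¹ *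
        ((if t < G.degree u then heavyDegree G t u else 0 : ℕ) : ℝ≥0∞) := by
    intro u
    simp only [h1, ← Finset.mul_sum]
    rw [mul_left_comm, ← mul_assoc (G.degree u : ℝ≥0∞), ENNReal.mul_inv_cancel (hd u) (by simp),
      one_mul]
    by_cases hu : t < G.degree u <;> simp [hu, heavyDegree_eq_sum]
  refine (congrArg _ (Finset.sum_congr rfl fun u _ => h2 u)).trans ?_
  rw [← Finset.mul_sum, ← Nat.cast_sum, ← mul_assoc, ← heavyPairs, ENNReal.div_eq_inv_mul]
  push_cast
  rw [sq, ENNReal.mul_inv (by simp) (by simp)]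

/-- A sample is at most `1 / (t + 1) ^ 2`, so averaging leaves variance at most `μ / ((t + 1) ^ 2 *
r) ≤ μ / D`. The lower bound on the heavy part gives `1 / D ≤ 5 / 2 * μ`. -/
theorem mean_pairBatch_sq_le [Nonempty V] (hdeg : ∀ v, 1 ≤ G.degree v) {t r : ℕ} (hr : 0 < r)
    (hhh : 2 * totalDegree G ≤ 5 * heavyPairs G t) (htr : totalDegree G ≤ (t + 1) ^ 2 * r) :
    mean G ident ((pairSample t).average r) (fun x => (x : ℝ≥0∞) ^ 2) ≤
      ENNReal.ofReal (21 * ((heavyPairs G t : ℝ) / (totalDegree G ^ 2 : ℕ)) ^ 2) := by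
  have hD : 0 < totalDegree G := Fintype.card_pos.trans_le (card_le_totalDegree hdeg)
  set μ : ℝ := (heavyPairs G t : ℝ) / (totalDegree G ^ 2 : ℕ) with hμ
  have h1 : mean G ident (pairSample t) (fun x => (x : ℝ≥0∞)) = ENNReal.ofReal μ := by
    rw [mean_pairSample hdeg, natCast_div_eq_ofReal _ (by positivity)]
  have h2 : mean G ident (pairSample t) (fun x => (x : ℝ≥0∞) ^ 2) ≤
      ENNReal.ofReal ((((t : ℝ) + 1) ^ 2)⁻¹ * μ) := by
    rw [ENNReal.ofReal_mul (by positivity), ← h1, ← mean_const_mul]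
    refine (pairSample_within t).mean_mono fun x hx => ?_
    rw [sq]
    gcongr
    rw [ENNReal.le_ofReal_iff_toReal_le (by simp) (by positivity)]
    exact_mod_cast hx
  have hr0 : (0 : ℝ) < r := by exact_mod_cast hr
  have hD0 : (0 : ℝ) < totalDegree G := by exact_mod_cast hD
  refine (mean_average_sq_le _ hr).trans ?_
  calc _ ≤ ENNReal.ofReal ((((t : ℝ) + 1) ^ 2)⁻¹ * μ) / r + ENNReal.ofReal μ ^ 2 := by
        rw [h1]; gcongr
    _ = ENNReal.ofReal ((((t : ℝ) + 1) ^ 2)⁻¹ * μ / r + μ ^ 2) := by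
        rw [ENNReal.ofReal_add (by positivity) (by positivity), ENNReal.ofReal_div_of_pos hr0,
          ENNReal.ofReal_natCast, ENNReal.ofReal_pow (by positivity)]
    _ ≤ _ := by
        refine ENNReal.ofReal_le_ofReal ?_
        have h3 : (totalDegree G : ℝ) ≤ ((t : ℝ) + 1) ^ 2 * r := by exact_mod_cast htr
        have h4 : (2 : ℝ) * totalDegree G ≤ 5 * heavyPairs G t := by exact_mod_cast hhh
        have h5 : (((t : ℝ) + 1) ^ 2)⁻¹ * μ / r ≤ (totalDegree G : ℝ)⁻¹ * μ := by
          rw [inv_mul_eq_div, inv_mul_eq_div, div_div]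
          gcongr
        have h6 : (totalDegree G : ℝ)⁻¹ ≤ 5 / 2 * μ := by
          rw [hμ]
          push_cast
          rw [← mul_div_assoc, le_div_iff₀ (by positivity)]
          field_simp
          linarith
        have h7 : 0 ≤ μ := by positivity
        -- Here `1 + 5 / 2` would suffice; `21` is the constant shared with the additive estimator.
        nlinarith [mul_le_mul_of_nonneg_right h6 h7]

end Mean

end Algorithm

/-! ### Random rounding, binary digits and bilinear forms -/

/-- Hermite's identity: adding a uniform `i < d` before the integer division by `d` rounds `n / d`
without bias. Raising `n` by one shifts the sum, trading the term `n / d` for `n / d + 1`. -/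
theorem sum_range_add_div (n : ℕ) {d : ℕ} (hd : 0 < d) :
    ∑ i ∈ Finset.range d, (n + i) / d = n := by
  induction n with
  | zero =>
    refine Finset.sum_eq_zero fun i hi => ?_
    rw [zero_add, Nat.div_eq_of_lt (Finset.mem_range.1 hi)]
  | succ n ih =>
    have h1 := Finset.sum_range_succ (fun i => (n + i) / d) d
    have h2 := Finset.sum_range_succ' (fun i => (n + i) / d) d
    simp only [add_zero] at h2
    have h3 : (n + d) / d = n / d + 1 := Nat.add_div_right n hd
    have h4 : ∑ i ∈ Finset.range d, (n + 1 + i) / d = ∑ i ∈ Finset.range d, (n + (i + 1)) / d :=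
      Finset.sum_congr rfl fun i _ => by rw [add_assoc, add_comm 1 i]
    omega

theorem sum_range_testBit {B n : ℕ} (h : n < 2 ^ B) :
    ∑ b ∈ Finset.range B, 2 ^ b * (if n.testBit b then 1 else 0) = n := by
  induction B generalizing n with
  | zero =>
    simp only [pow_zero, Nat.lt_one_iff] at h
    simp [h]
  | succ B ih =>
    have h1 : n / 2 < 2 ^ B := by rw [pow_succ] at h; omega
    have h2 := ih h1
    rw [Finset.sum_range_succ']
    simp only [Nat.testBit_succ, pow_succ, Nat.testBit_zero, pow_zero, one_mul]
    have h3 : ∑ b ∈ Finset.range B, 2 ^ b * 2 * (if (n / 2).testBit b then 1 else 0) =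
        2 * ∑ b ∈ Finset.range B, 2 ^ b * (if (n / 2).testBit b then 1 else 0) := by
      rw [Finset.mul_sum]
      exact Finset.sum_congr rfl fun b _ => by ring
    rw [h3, h2]
    by_cases h4 : n % 2 = 1 <;> simp [h4] <;> omega

/-- The number of pairs in `l` with first entry `x`, weighted by the second entries. -/
def weightAt (l : List (ℕ × ℕ)) (x : ℕ) : ℕ := (l.map fun p => if p.1 = x then p.2 else 0).sum

/-- The set of those `x` for which the binary digit number `b` of `weightAt l x` is `1`. -/
def digitLayer (l : List (ℕ × ℕ)) (b : ℕ) : Finset ℕ :=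
  (l.map Prod.fst).toFinset.filter fun x => (weightAt l x).testBit b

theorem weightAt_eq_zero {l : List (ℕ × ℕ)} {x : ℕ} (h : x ∉ l.map Prod.fst) :
    weightAt l x = 0 := by
  refine List.sum_eq_zero fun k hk => ?_
  obtain ⟨p, hp, rfl⟩ := List.mem_map.1 hk
  rw [if_neg]
  rintro rfl
  exact h (List.mem_map_of_mem hp)

theorem mem_digitLayer {l : List (ℕ × ℕ)} {b x : ℕ} :
    x ∈ digitLayer l b ↔ (weightAt l x).testBit b = true := by
  simp only [digitLayer, Finset.mem_filter, List.mem_toFinset, and_iff_right_iff_imp]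
  intro h
  by_contra hx
  simp [weightAt_eq_zero hx] at h

theorem card_digitLayer_le (l : List (ℕ × ℕ)) (b : ℕ) : (digitLayer l b).card ≤ l.length :=
  (Finset.card_filter_le _ _).trans ((List.toFinset_card_le _).trans (by simp))

theorem weightAt_le {l : List (ℕ × ℕ)} {c : ℕ} (h : ∀ p ∈ l, p.2 ≤ c) (x : ℕ) :
    weightAt l x ≤ l.length * c := by
  refine (List.sum_le_card_nsmul _ c ?_).trans (by simp)
  intro k hk
  obtain ⟨p, hp, rfl⟩ := List.mem_map.1 hk
  split_ifs
  exacts [h p hp, Nat.zero_le _]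

section Graph

variable {V : Type*} [Fintype V] [DecidableEq V] (G : SimpleGraph V) [DecidableRel G.Adj]
  (ident : V ↪ ℕ)

/-- The sum of `f u * g v` over the ordered adjacent pairs of vertices. -/
def bilinear (f g : ℕ → ℕ) : ℕ := ∑ u, ∑ v ∈ G.neighborFinset u, f (ident u) * g (ident v)

/-- The indicator function of a set of identifiers. -/
def indic (S : Finset ℕ) (x : ℕ) : ℕ := if x ∈ S then 1 else 0

/-- The number of edges inside a set of identifiers. -/
def inducedEdges (S : Finset ℕ) : ℕ := (G.edgeFinset.filter fun e => ∀ v ∈ e, ident v ∈ S).card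

theorem two_mul_inducedEdges (S : Finset ℕ) :
    2 * inducedEdges G ident S = bilinear G ident (indic S) (indic S) := by
  rw [inducedEdges, Finset.card_filter, ← smul_eq_mul,
    ← sum_neighbor_edge G fun e => if ∀ v ∈ e, ident v ∈ S then 1 else 0]
  refine Finset.sum_congr rfl fun u _ => Finset.sum_congr rfl fun v _ => ?_
  by_cases hu : ident u ∈ S <;> by_cases hv : ident v ∈ S <;> simp [indic, hu, hv]

theorem bilinear_comm (f g : ℕ → ℕ) : bilinear G ident f g = bilinear G ident g f := by
  unfold bilinear
  rw [sum_neighbor_comm]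
  simp only [mul_comm]

/-- Split `A ∪ B` into `A \ B`, `A ∩ B` and `B \ A`. Edges inside `A ∩ B` are counted twice on both
sides, matching their two orientations in `A × B`. Being free of subtraction, the identity also
shows that the truncated difference in `crossPairs` is exact. -/
theorem inducedEdges_union_add_inter (A B : Finset ℕ) :
    inducedEdges G ident (A ∪ B) + inducedEdges G ident (A ∩ B) =
      bilinear G ident (indic A) (indic B) + inducedEdges G ident (A \ B) +
        inducedEdges G ident (B \ A) := by
  have h : bilinear G ident (indic (A ∪ B)) (indic (A ∪ B)) +
      bilinear G ident (indic (A ∩ B)) (indic (A ∩ B)) =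
      bilinear G ident (indic A) (indic B) + bilinear G ident (indic B) (indic A) +
      bilinear G ident (indic (A \ B)) (indic (A \ B)) +
      bilinear G ident (indic (B \ A)) (indic (B \ A)) := by
    simp only [bilinear, ← Finset.sum_add_distrib]
    refine Finset.sum_congr rfl fun u _ => Finset.sum_congr rfl fun v _ => ?_
    by_cases h1 : ident u ∈ A <;> by_cases h2 : ident v ∈ A <;> by_cases h3 : ident u ∈ B <;>
      by_cases h4 : ident v ∈ B <;> simp [indic, h1, h2, h3, h4]
  rw [bilinear_comm G ident (indic B), ← two_mul_inducedEdges, ← two_mul_inducedEdges,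
    ← two_mul_inducedEdges, ← two_mul_inducedEdges] at h
  omega

/-- Additive queries see only sets, while the samples carry multiplicities and weights. Binary
expansion reduces the weighted form to set-versus-set counts, one for each pair of digits. -/
theorem bilinear_digits {B : ℕ} {l l' : List (ℕ × ℕ)} (hl : ∀ x, weightAt l x < 2 ^ B)
    (hl' : ∀ x, weightAt l' x < 2 ^ B) :
    ∑ b ∈ Finset.range B, ∑ b' ∈ Finset.range B,
        2 ^ (b + b') * bilinear G ident (indic (digitLayer l b)) (indic (digitLayer l' b')) =
      bilinear G ident (weightAt l) (weightAt l') := by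
  have h : ∀ {l : List (ℕ × ℕ)}, (∀ x, weightAt l x < 2 ^ B) → ∀ x,
      weightAt l x = ∑ b ∈ Finset.range B, 2 ^ b * indic (digitLayer l b) x := by
    intro l hl x
    conv_lhs => rw [← sum_range_testBit (hl x)]
    simp only [indic, mem_digitLayer]
  have h2 : bilinear G ident (weightAt l) (weightAt l') = ∑ u, ∑ v ∈ G.neighborFinset u,
      ∑ b ∈ Finset.range B, ∑ b' ∈ Finset.range B, 2 ^ (b + b') *
        (indic (digitLayer l b) (ident u) * indic (digitLayer l' b') (ident v)) := by
    unfold bilinear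
    refine Finset.sum_congr rfl fun u _ => Finset.sum_congr rfl fun v _ => ?_
    rw [h hl, h hl', Finset.sum_mul_sum]
    refine Finset.sum_congr rfl fun b _ => Finset.sum_congr rfl fun b' _ => ?_
    ring
  have h3 : ∀ u, ∑ v ∈ G.neighborFinset u,
      ∑ b ∈ Finset.range B, ∑ b' ∈ Finset.range B, 2 ^ (b + b') *
        (indic (digitLayer l b) (ident u) * indic (digitLayer l' b') (ident v)) =
      ∑ b ∈ Finset.range B, ∑ b' ∈ Finset.range B, ∑ v ∈ G.neighborFinset u, 2 ^ (b + b') *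
        (indic (digitLayer l b) (ident u) * indic (digitLayer l' b') (ident v)) := by
    intro u
    rw [Finset.sum_comm]
    refine Finset.sum_congr rfl fun b _ => ?_
    rw [Finset.sum_comm]
  simp only [h2, h3]
  symm
  rw [Finset.sum_comm]
  refine Finset.sum_congr rfl fun b _ => ?_
  rw [Finset.sum_comm]
  refine Finset.sum_congr rfl fun b' _ => ?_
  simp only [bilinear, Finset.mul_sum]

/-- Whether `x` and `y` are the identifiers of adjacent vertices. -/
noncomputable def adjacency (x y : ℕ) : ℕ :=
  bilinear G ident (fun z => if x = z then 1 else 0) (fun z => if y = z then 1 else 0)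

theorem adjacency_comm (x y : ℕ) : adjacency G ident x y = adjacency G ident y x :=
  bilinear_comm G ident _ _

theorem adjacency_ident (u v : V) :
    adjacency G ident (ident u) (ident v) = if G.Adj u v then 1 else 0 := by
  have h : ∀ x, (∑ y ∈ G.neighborFinset x, (if u = x then 1 else 0) * (if v = y then 1 else 0)) =
      if u = x then if G.Adj x v then 1 else 0 else 0 := fun x => by
    simp
    split_ifs <;> rfl
  simp only [adjacency, bilinear, ident.injective.eq_iff, h, Finset.sum_ite_eq, Finset.mem_univ,
    if_true]

theorem bilinear_add_left (f f' g : ℕ → ℕ) : bilinear G ident (fun x => f x + f' x) g =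
    bilinear G ident f g + bilinear G ident f' g := by
  simp only [bilinear, add_mul, Finset.sum_add_distrib]

theorem bilinear_mul_left (c : ℕ) (f g : ℕ → ℕ) : bilinear G ident (fun x => c * f x) g =
    c * bilinear G ident f g := by
  simp only [bilinear, mul_assoc, Finset.mul_sum]

theorem bilinear_weightAt_left (l : List (ℕ × ℕ)) (g : ℕ → ℕ) :
    bilinear G ident (weightAt l) g =
      (l.map fun p => p.2 * bilinear G ident (fun z => if p.1 = z then 1 else 0) g).sum := by
  induction l with
  | nil => simp [bilinear, weightAt]
  | cons p l ih =>
    rw [List.map_cons, List.sum_cons, ← ih, ← bilinear_mul_left, ← bilinear_add_left]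
    congr 1
    funext x
    simp [weightAt]

theorem bilinear_weightAt (l l' : List (ℕ × ℕ)) :
    bilinear G ident (weightAt l) (weightAt l') =
      (l'.map fun b => (l.map fun a => a.2 * b.2 * adjacency G ident a.1 b.1).sum).sum := by
  rw [bilinear_comm, bilinear_weightAt_left]
  congr 1
  refine List.map_congr_left fun b _ => ?_
  rw [bilinear_comm, bilinear_weightAt_left, ← List.sum_map_mul_left]
  congr 1
  refine List.map_congr_left fun a _ => ?_
  rw [adjacency]
  ring

end Graph

/-! ### Heavy-edge frequency from additive queries -/

namespace Algorithm

variable {M : Access} {α : Type}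

section ListSum

variable {V : Type*} [Fintype V] [DecidableEq V] (G : SimpleGraph V) [DecidableRel G.Adj]
  (ident : V ↪ ℕ)

theorem mean_list_sum (A : Algorithm M α) {β : Type} (l : List β) (k : β → α → ℝ≥0∞) :
    mean G ident A (fun a => (l.map fun b => k b a).sum) =
      (l.map fun b => mean G ident A (k b)).sum := by
  induction l with
  | nil => simp [mean_const]
  | cons b l ih => simp only [List.map_cons, List.sum_cons, mean_add, ih]

theorem mean_replicate_bilinear (A : Algorithm M α) (k : α → α → ℝ≥0∞) (r : ℕ) :
    (mean G ident (A.replicate r) fun l => mean G ident (A.replicate r) fun l' =>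
      (l'.map fun b => (l.map fun a => k a b).sum).sum) =
      r ^ 2 * mean G ident A fun a => mean G ident A (k a) := by
  simp only [mean_replicate_sum, mean_const_mul, mean_list_sum]
  ring

/-- The one-sample bound applied twice, to `l'` with `l` fixed and then to `l`. The three terms come
from pairs of index pairs sharing both indices, one index or none; symmetry of `k` merges the two
one-index cases. -/
theorem mean_replicate_bilinear_sq_le (A : Algorithm M α) (k : α → α → ℝ≥0∞)
    (hk : ∀ a b, k a b = k b a) (r : ℕ) :
    (mean G ident (A.replicate r) fun l => mean G ident (A.replicate r) fun l' =>
      (l'.map fun b => (l.map fun a => k a b).sum).sum ^ 2) ≤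
      r ^ 2 * (mean G ident A fun a => mean G ident A fun b => k a b ^ 2) +
      2 * r ^ 3 * (mean G ident A fun a => mean G ident A (k a) ^ 2) +
      r ^ 4 * (mean G ident A fun a => mean G ident A (k a)) ^ 2 := by
  have hsym : ∀ b, (mean G ident A fun a => k a b) = mean G ident A (k b) := fun b => by
    simp only [fun a => hk a b]
  calc _ ≤ mean G ident (A.replicate r) fun l =>
        r * mean G ident A (fun b => (l.map fun a => k a b).sum ^ 2) +
        r ^ 2 * (l.map fun a => mean G ident A (k a)).sum ^ 2 := by
        refine mean_mono _ _ _ fun l => ?_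
        refine (mean_replicate_sum_sq_le G ident A _ r).trans ?_
        rw [mean_list_sum]
    _ = r * mean G ident A (fun b => mean G ident (A.replicate r) fun l =>
          (l.map fun a => k a b).sum ^ 2) +
        r ^ 2 * mean G ident (A.replicate r) fun l =>
          (l.map fun a => mean G ident A (k a)).sum ^ 2 := by
        rw [mean_add, mean_const_mul, mean_const_mul, mean_comm]
    _ ≤ r * mean G ident A (fun b => r * mean G ident A (fun a => k a b ^ 2) +
          r ^ 2 * mean G ident A (k b) ^ 2) +
        r ^ 2 * (r * (mean G ident A fun a => mean G ident A (k a) ^ 2) +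
          r ^ 2 * (mean G ident A fun a => mean G ident A (k a)) ^ 2) := by
        gcongr
        · refine mean_mono _ _ _ fun b => ?_
          refine (mean_replicate_sum_sq_le G ident A _ r).trans ?_
          rw [hsym]
        · exact mean_replicate_sum_sq_le G ident A _ r
    _ = _ := by
        rw [mean_add, mean_const_mul, mean_const_mul, mean_comm G ident A A]
        ring

end ListSum

/-- Ask for the number of edges inside a set. -/
def askAdditive (S : Finset ℕ) (next : ℕ → Algorithm .additive α) : Algorithm .additive α :=
  .ask (.additive S) next

theorem Within.askAdditive {c : ℕ} {P : α → Prop} {S : Finset ℕ}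
    {next : ℕ → Algorithm .additive α} (h : ∀ a, (next a).Within c P) :
    (askAdditive S next).Within (S.card + c) P :=
  ⟨Nat.le_add_right _ _, fun a => (h a).mono (by simp [Query.cost]) fun _ => id⟩

/-- A random endpoint of a random edge with a random integer weight, which has mean `n / d` if
the degree `d` is above `t`, and is zero otherwise. -/
noncomputable def weightedEndpoint (n t : ℕ) : Algorithm M (ℕ × ℕ) :=
  endpointDegree.bind fun x => .sample (uniformOr (Finset.range x.2) 0) fun i =>
    -- The reduction modulo `x.2` changes nothing for sampled `i < x.2`; it bounds the weight for
    -- every `i`, as `Within` demands.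
    .output (x.1, if t < x.2 then (n + i % x.2) / x.2 else 0)

theorem weightedEndpoint_within (n t : ℕ) :
    (weightedEndpoint n t : Algorithm M (ℕ × ℕ)).Within 2 fun p => p.2 ≤ n + 1 := by
  refine endpointDegree_within.bind (c' := 0) fun x _ => .sample fun i => .output ?_
  show (if t < x.2 then (n + i % x.2) / x.2 else 0) ≤ n + 1
  split_ifs with h
  · have hx : 0 < x.2 := by omega
    have := Nat.mod_lt i hx
    calc (n + i % x.2) / x.2 ≤ (n + x.2) / x.2 := Nat.div_le_div_right (by omega)
      _ = n / x.2 + 1 := Nat.add_div_right n hx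
      _ ≤ n + 1 := by gcongr; exact Nat.div_le_self _ _
  · exact Nat.zero_le _

/-- The sum of the outputs of the first `k` members of a family of algorithms. -/
def sumRange (f : ℕ → Algorithm M ℕ) : ℕ → Algorithm M ℕ
  | 0 => .output 0
  | k + 1 => (sumRange f k).bind fun s => (f k).bind fun c => .output (s + c)

theorem Within.sumRange {f : ℕ → Algorithm M ℕ} {c : ℕ} (h : ∀ i, (f i).Within c fun _ => True)
    (k : ℕ) : (sumRange f k).Within (k * c) fun _ => True := by
  induction k with
  | zero => exact .output trivial
  | succ k ih =>
    exact (ih.bind fun _ _ => (h k).bind (c' := 0) (Q := fun _ => True) fun _ _ =>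
      .output trivial).mono (by linarith) fun _ => id

/-- The number of ordered adjacent pairs in `A ×ˢ B`. -/
def crossPairs (A B : Finset ℕ) : Algorithm .additive ℕ :=
  askAdditive (A ∪ B) fun a => askAdditive (A ∩ B) fun b => askAdditive (A \ B) fun c =>
    askAdditive (B \ A) fun d => .output (a + b - (c + d))

theorem crossPairs_within (A B : Finset ℕ) :
    (crossPairs A B).Within (2 * (A.card + B.card)) fun _ => True := by
  refine Within.mono (.askAdditive fun _ => .askAdditive fun _ => .askAdditive fun _ =>
    .askAdditive (c := 0) (P := fun _ => True) fun _ => .output trivial) ?_ fun _ => id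
  have h1 := Finset.card_union_add_card_inter A B
  have h2 := Finset.card_le_card (Finset.sdiff_subset (s := A) (t := B))
  have h3 := Finset.card_le_card (Finset.sdiff_subset (s := B) (t := A))
  omega

/-- The value of `bilinear G ident (weightAt l) (weightAt l')`, computed from the first `B`
binary digits of the weights. -/
def weightedPairs (B : ℕ) (l l' : List (ℕ × ℕ)) : Algorithm .additive ℕ :=
  sumRange (fun b => sumRange (fun b' => (crossPairs (digitLayer l b) (digitLayer l' b')).bind
    fun c => .output (2 ^ (b + b') * c)) B) B

theorem weightedPairs_within (B : ℕ) {r : ℕ} {l l' : List (ℕ × ℕ)} (hl : l.length = r)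
    (hl' : l'.length = r) : (weightedPairs B l l').Within (B * (B * (4 * r))) fun _ => True := by
  refine .sumRange (fun b => .sumRange (fun b' => ?_) B) B
  refine ((crossPairs_within _ _).bind (c' := 0) (Q := fun _ => True) fun _ _ =>
    .output trivial).mono ?_ fun _ => id
  have h1 := card_digitLayer_le l b
  have h2 := card_digitLayer_le l' b'
  omega

/-- An estimator built from all the pairs between two samples of `r` weighted endpoints. -/
noncomputable def additiveBatch (n t r B : ℕ) : Algorithm .additive ℝ≥0 :=
  ((weightedEndpoint n t).replicate r).bind fun l =>
    ((weightedEndpoint n t).replicate r).bind fun l' =>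
      (weightedPairs B l l').bind fun c => .output (c / ((n : ℝ≥0) * r) ^ 2)

theorem additiveBatch_within (n t r B : ℕ) :
    (additiveBatch n t r B).Within (4 * r * (1 + B ^ 2)) fun _ => True := by
  refine Within.mono (((weightedEndpoint_within n t).replicate r).bind fun l hl =>
    ((weightedEndpoint_within n t).replicate r).bind fun l' hl' =>
      (weightedPairs_within B hl.1 hl'.1).bind (c' := 0) (Q := fun _ => True) fun _ _ =>
        .output trivial) (le_of_eq (by ring)) fun _ => id

section Mean

variable {V : Type*} [Fintype V] [DecidableEq V] {G : SimpleGraph V} [DecidableRel G.Adj]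
  {ident : V ↪ ℕ}

theorem mean_askAdditive (S : Finset ℕ) (next : ℕ → Algorithm .additive α) (φ : α → ℝ≥0∞) :
    mean G ident (askAdditive S next) φ = mean G ident (next (inducedEdges G ident S)) φ :=
  (mean_ask (M := .additive) G ident (.additive S) next φ).trans
    (expect_pure (inducedEdges G ident S) fun a => mean G ident (next a) φ)

theorem mean_crossPairs (A B : Finset ℕ) (φ : ℕ → ℝ≥0∞) :
    mean G ident (crossPairs A B) φ = φ (bilinear G ident (indic A) (indic B)) := by
  simp only [crossPairs, mean_askAdditive, mean_output]
  rw [inducedEdges_union_add_inter, add_assoc, Nat.add_sub_cancel]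

theorem mean_sumRange {f : ℕ → Algorithm M ℕ} {v : ℕ → ℕ}
    (h : ∀ i φ, mean G ident (f i) φ = φ (v i)) (k : ℕ) (φ : ℕ → ℝ≥0∞) :
    mean G ident (sumRange f k) φ = φ (∑ i ∈ Finset.range k, v i) := by
  induction k generalizing φ with
  | zero => simp [sumRange, mean_output]
  | succ k ih => simp only [sumRange, mean_bind, ih, h, mean_output, Finset.sum_range_succ]

theorem mean_weightedPairs {B : ℕ} {l l' : List (ℕ × ℕ)} (hl : ∀ x, weightAt l x < 2 ^ B)
    (hl' : ∀ x, weightAt l' x < 2 ^ B) (φ : ℕ → ℝ≥0∞) :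
    mean G ident (weightedPairs B l l') φ =
      φ (bilinear G ident (weightAt l) (weightAt l')) := by
  rw [← bilinear_digits G ident hl hl']
  refine mean_sumRange (fun b φ => mean_sumRange (fun b' φ => ?_) B φ) B φ
  rw [mean_bind, mean_crossPairs, mean_output]

/-- Degree-proportional sampling times the unbiased weight `n / deg v` gives every heavy vertex the
same total mass `n / D`. -/
theorem mean_weightedEndpoint [Nonempty V] (hdeg : ∀ v, 1 ≤ G.degree v) (n t : ℕ)
    (f : ℕ → ℝ≥0∞) :
    mean G ident (weightedEndpoint n t : Algorithm M (ℕ × ℕ)) (fun p => p.2 * f p.1) =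
      n / totalDegree G * ∑ v, if t < G.degree v then f (ident v) else 0 := by
  simp only [weightedEndpoint, mean_bind, mean_endpointDegree hdeg, mean_sample, mean_output]
  rw [ENNReal.div_eq_inv_mul, mul_assoc, Finset.mul_sum (a := (n : ℝ≥0∞))]
  congr 1
  refine Finset.sum_congr rfl fun v _ => ?_
  have hv := hdeg v
  have hd : (G.degree v : ℝ≥0∞) ≠ 0 := by
    simp only [ne_eq, Nat.cast_eq_zero]
    omega
  rw [expect_uniformOr (by simpa using Nat.one_le_iff_ne_zero.1 hv), Finset.card_range, ← mul_assoc,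
    ENNReal.mul_inv_cancel hd (by simp), one_mul, ← Finset.sum_mul]
  split_ifs with h
  · rw [← Nat.cast_sum, Finset.sum_congr rfl (g := fun i => (n + i) / G.degree v),
      sum_range_add_div n hv]
    intro i hi
    rw [Nat.mod_eq_of_lt (Finset.mem_range.1 hi)]
  · simp

/-- Because `deg v < n`, a rounded weight `w` satisfies `w * deg v ≤ 2 * n`: rounding at scale `n`
costs only a factor `2` in the second moment. -/
theorem mean_weightedEndpoint_sq_le [Nonempty V] (hdeg : ∀ v, 1 ≤ G.degree v) (t : ℕ)
    (f : ℕ → ℝ≥0∞) :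
    mean G ident (weightedEndpoint (Fintype.card V) t : Algorithm M (ℕ × ℕ))
        (fun p => (p.2 : ℝ≥0∞) ^ 2 * f p.1) ≤
      2 * (Fintype.card V : ℝ≥0∞) ^ 2 / totalDegree G *
        ∑ v, if t < G.degree v then f (ident v) / G.degree v else 0 := by
  set n := Fintype.card V
  simp only [weightedEndpoint, mean_bind, mean_endpointDegree hdeg, mean_sample, mean_output]
  rw [ENNReal.div_eq_inv_mul, mul_assoc, Finset.mul_sum (a := 2 * (n : ℝ≥0∞) ^ 2)]
  refine mul_le_mul_right (Finset.sum_le_sum fun v _ => ?_) _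
  have hv := hdeg v
  have hd : (G.degree v : ℝ≥0∞) ≠ 0 := by
    simp only [ne_eq, Nat.cast_eq_zero]
    omega
  rw [expect_uniformOr (by simpa using Nat.one_le_iff_ne_zero.1 hv), Finset.card_range, ← mul_assoc,
    ENNReal.mul_inv_cancel hd (by simp), one_mul, ← Finset.sum_mul]
  split_ifs with h
  · rw [mul_div_assoc', ENNReal.mul_div_right_comm]
    gcongr
    rw [ENNReal.le_div_iff_mul_le (.inl hd) (.inl (by simp))]
    have h1 : (∑ i ∈ Finset.range (G.degree v),
        ((n + i % G.degree v) / G.degree v) ^ 2) * G.degree v ≤ 2 * n ^ 2 := by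
      calc (∑ i ∈ Finset.range (G.degree v), ((n + i % G.degree v) / G.degree v) ^ 2) * G.degree v
          ≤ ∑ i ∈ Finset.range (G.degree v), 2 * n * ((n + i) / G.degree v) := by
            rw [Finset.sum_mul]
            refine Finset.sum_le_sum fun i hi => ?_
            rw [Nat.mod_eq_of_lt (Finset.mem_range.1 hi), sq, mul_assoc, mul_comm]
            refine Nat.mul_le_mul_right _ ?_
            have h2 := Nat.div_mul_le_self (n + i) (G.degree v)
            have h3 : G.degree v < n := G.degree_lt_card_verts v
            have h4 := Finset.mem_range.1 hi
            omega
        _ = _ := by rw [← Finset.mul_sum, sum_range_add_div n hv]; ring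
    exact_mod_cast h1
  · simp

end Mean

section Mean

variable {M : Access} {V : Type*} [Fintype V] [DecidableEq V] {G : SimpleGraph V}
  [DecidableRel G.Adj] {ident : V ↪ ℕ}

/-- The contribution of two weighted vertices to the additive estimator. -/
noncomputable def pairWeight (G : SimpleGraph V) [DecidableRel G.Adj] (ident : V ↪ ℕ)
    (a b : ℕ × ℕ) : ℝ≥0∞ := a.2 * (b.2 * adjacency G ident a.1 b.1)

theorem pairWeight_comm (a b : ℕ × ℕ) : pairWeight G ident a b = pairWeight G ident b a := by
  rw [pairWeight, pairWeight, adjacency_comm, mul_left_comm]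

theorem bilinear_weightAt_cast (l l' : List (ℕ × ℕ)) :
    (bilinear G ident (weightAt l) (weightAt l') : ℝ≥0∞) =
      (l'.map fun b => (l.map fun a => pairWeight G ident a b).sum).sum := by
  rw [bilinear_weightAt]
  simp only [Nat.cast_list_sum, List.map_map, Function.comp_def, pairWeight,
    Nat.cast_mul, mul_assoc]

theorem mean_additiveBatch {n t r B : ℕ} (hB : r * (n + 1) < 2 ^ B) (φ : ℝ≥0 → ℝ≥0∞) :
    mean G ident (additiveBatch n t r B) φ =
      mean G ident ((weightedEndpoint n t).replicate r : Algorithm .additive _) fun l =>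
        mean G ident ((weightedEndpoint n t).replicate r : Algorithm .additive _) fun l' =>
          φ (bilinear G ident (weightAt l) (weightAt l') / ((n : ℝ≥0) * r) ^ 2) := by
  have h : ∀ l : List (ℕ × ℕ), (l.length = r ∧ ∀ p ∈ l, p.2 ≤ n + 1) →
      ∀ x, weightAt l x < 2 ^ B := fun l hl x => by
    have := weightAt_le hl.2 x
    rw [hl.1] at this
    omega
  rw [additiveBatch, mean_bind]
  refine ((weightedEndpoint_within n t).replicate r).mean_congr fun l hl => ?_
  rw [mean_bind]
  refine ((weightedEndpoint_within n t).replicate r).mean_congr fun l' hl' => ?_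
  rw [mean_bind, mean_weightedPairs (h l hl) (h l' hl'), mean_output]

theorem sum_adjacency_eq_heavyDegree (t : ℕ) (u : V) :
    (∑ v, if t < G.degree v then (adjacency G ident (ident u) (ident v) : ℝ≥0∞) else 0) =
      heavyDegree G t u := by
  rw [heavyDegree_eq_sum]
  refine Finset.sum_congr rfl fun v _ => ?_
  rw [adjacency_ident]
  push_cast
  rfl

theorem mean_pairWeight_left [Nonempty V] (hdeg : ∀ v, 1 ≤ G.degree v) (n t : ℕ) (a : ℕ × ℕ) :
    mean G ident (weightedEndpoint n t : Algorithm M (ℕ × ℕ)) (pairWeight G ident a) =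
      a.2 * (n / totalDegree G * ∑ v, if t < G.degree v then
        (adjacency G ident a.1 (ident v) : ℝ≥0∞) else 0) := by
  unfold pairWeight
  rw [mean_const_mul]
  exact congrArg _ (mean_weightedEndpoint hdeg n t fun x => (adjacency G ident a.1 x : ℝ≥0∞))

theorem mean_pairWeight [Nonempty V] (hdeg : ∀ v, 1 ≤ G.degree v) (n t : ℕ) :
    (mean G ident (weightedEndpoint n t : Algorithm M (ℕ × ℕ)) fun a =>
      mean G ident (weightedEndpoint n t : Algorithm M (ℕ × ℕ)) (pairWeight G ident a)) =
      (n / totalDegree G : ℝ≥0∞) ^ 2 * heavyPairs G t := by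
  simp only [mean_pairWeight_left hdeg]
  rw [mean_weightedEndpoint hdeg n t fun x => n / totalDegree G * ∑ v, if t < G.degree v then
        (adjacency G ident x (ident v) : ℝ≥0∞) else 0]
  simp only [sum_adjacency_eq_heavyDegree]
  rw [sq, mul_assoc, heavyPairs]
  push_cast
  congr 1
  rw [Finset.mul_sum]
  refine Finset.sum_congr rfl fun u _ => ?_
  split_ifs <;> simp

/-- The one-shared-index term. For heavy `u` the second moment involves `heavyDegree G t u ^ 2 / deg
u`, which is at most `heavyDegree G t u`. -/
theorem mean_pairWeight_star_le [Nonempty V] (hdeg : ∀ v, 1 ≤ G.degree v) (t : ℕ) :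
    (mean G ident (weightedEndpoint (Fintype.card V) t : Algorithm M (ℕ × ℕ)) fun a =>
      mean G ident (weightedEndpoint (Fintype.card V) t : Algorithm M (ℕ × ℕ))
        (pairWeight G ident a) ^ 2) ≤
      2 * (Fintype.card V : ℝ≥0∞) ^ 2 / totalDegree G *
        ((Fintype.card V / totalDegree G : ℝ≥0∞) ^ 2 * heavyPairs G t) := by
  simp only [mean_pairWeight_left hdeg, mul_pow (M := ℝ≥0∞)]
  refine (mean_weightedEndpoint_sq_le hdeg t fun x =>
    (Fintype.card V / totalDegree G : ℝ≥0∞) ^ 2 * (∑ v, if t < G.degree v then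
        (adjacency G ident x (ident v) : ℝ≥0∞) else 0) ^ 2).trans ?_
  simp only [sum_adjacency_eq_heavyDegree]
  rw [heavyPairs]
  push_cast
  rw [Finset.mul_sum (a := (Fintype.card V / totalDegree G : ℝ≥0∞) ^ 2)]
  refine mul_le_mul_right (Finset.sum_le_sum fun u _ => ?_) _
  split_ifs
  · rw [mul_div_assoc]
    gcongr
    refine ENNReal.div_le_of_le_mul ?_
    rw [sq]
    gcongr
    exact heavyDegree_le G t u
  · simp

/-- The two-shared-indices term. An adjacent heavy pair contributes `1 / (deg u * deg v) ≤ 1 / (t +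
1) ^ 2`. -/
theorem mean_pairWeight_sq_le [Nonempty V] (hdeg : ∀ v, 1 ≤ G.degree v) (t : ℕ) :
    (mean G ident (weightedEndpoint (Fintype.card V) t : Algorithm M (ℕ × ℕ)) fun a =>
      mean G ident (weightedEndpoint (Fintype.card V) t : Algorithm M (ℕ × ℕ)) fun b =>
        pairWeight G ident a b ^ 2) ≤
      2 * (Fintype.card V : ℝ≥0∞) ^ 2 / totalDegree G *
        (2 * (Fintype.card V : ℝ≥0∞) ^ 2 / totalDegree G *
        (((t : ℝ≥0∞) + 1)⁻¹ ^ 2 * heavyPairs G t)) := by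
  simp only [pairWeight, mul_pow (M := ℝ≥0∞), mean_const_mul]
  set n := Fintype.card V
  calc _ ≤ mean G ident (weightedEndpoint n t : Algorithm M (ℕ × ℕ)) (fun a =>
        (a.2 : ℝ≥0∞) ^ 2 * (2 * (n : ℝ≥0∞) ^ 2 / totalDegree G * ∑ v, if t < G.degree v then
          (adjacency G ident a.1 (ident v) : ℝ≥0∞) ^ 2 / G.degree v else 0)) := by
        refine mean_mono _ _ _ fun a => ?_
        gcongr
        exact mean_weightedEndpoint_sq_le hdeg t fun x => (adjacency G ident a.1 x : ℝ≥0∞) ^ 2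
    _ ≤ _ := mean_weightedEndpoint_sq_le hdeg t fun x => 2 * (n : ℝ≥0∞) ^ 2 / totalDegree G *
        ∑ v, if t < G.degree v then (adjacency G ident x (ident v) : ℝ≥0∞) ^ 2 / G.degree v else 0
    _ ≤ _ := ?_
  refine mul_le_mul_right ?_ _
  rw [heavyPairs]
  push_cast
  rw [Finset.mul_sum, Finset.mul_sum]
  refine Finset.sum_le_sum fun u _ => ?_
  have hinv : ∀ u : V, t < G.degree u → (G.degree u : ℝ≥0∞)⁻¹ ≤ ((t : ℝ≥0∞) + 1)⁻¹ := by
    intro u hu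
    rw [ENNReal.inv_le_inv]
    exact_mod_cast hu
  split_ifs with hu
  · rw [mul_div_assoc]
    refine mul_le_mul_right ?_ _
    rw [heavyDegree_eq_sum, ENNReal.div_eq_inv_mul, Finset.mul_sum, Finset.mul_sum]
    refine Finset.sum_le_sum fun v _ => ?_
    split_ifs with hv huv
    · rw [adjacency_ident, if_pos huv, ENNReal.div_eq_inv_mul, ← mul_assoc, sq]
      push_cast
      rw [one_mul, mul_one, mul_one, sq]
      exact mul_le_mul' (hinv u hu) (hinv v hv)
    · simp [adjacency_ident, huv]
    · simp
  · simp

theorem additiveBatch_coe (c : ℕ) {n r : ℕ} (hn : 0 < n) (hr : 0 < r) :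
    (((c : ℝ≥0) / ((n : ℝ≥0) * r) ^ 2 : ℝ≥0) : ℝ≥0∞) =
      ((n : ℝ≥0∞) * r)⁻¹ ^ 2 * c := by
  rw [ENNReal.coe_div (by positivity), ENNReal.div_eq_inv_mul]
  push_cast
  rw [ENNReal.inv_pow]

theorem mean_additiveBatch_coe [Nonempty V] (hdeg : ∀ v, 1 ≤ G.degree v) {t r B : ℕ} (hr : 0 < r)
    (hB : r * (Fintype.card V + 1) < 2 ^ B) :
    mean G ident (additiveBatch (Fintype.card V) t r B) (fun x => (x : ℝ≥0∞)) =
      heavyPairs G t / (totalDegree G ^ 2 : ℕ) := by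
  have hn : 0 < Fintype.card V := Fintype.card_pos
  rw [mean_additiveBatch hB]
  simp only [additiveBatch_coe _ hn hr, mean_const_mul, bilinear_weightAt_cast,
    mean_replicate_bilinear, mean_pairWeight hdeg]
  have h1 : (Fintype.card V : ℝ≥0∞)⁻¹ * Fintype.card V = 1 :=
    ENNReal.inv_mul_cancel (by simp) (by simp)
  have h2 : (r : ℝ≥0∞)⁻¹ * r = 1 := ENNReal.inv_mul_cancel (by simpa using hr.ne') (by simp)
  rw [ENNReal.mul_inv (by simp) (by simp), ENNReal.div_eq_inv_mul, ENNReal.div_eq_inv_mul]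
  push_cast
  calc _ = ((Fintype.card V : ℝ≥0∞)⁻¹ * Fintype.card V) ^ 2 * ((r : ℝ≥0∞)⁻¹ * r) ^ 2 *
        ((totalDegree G : ℝ≥0∞)⁻¹ ^ 2 * heavyPairs G t) := by ring
    _ = _ := by rw [h1, h2, one_pow, one_mul, one_mul, ENNReal.inv_pow]

theorem mean_additiveBatch_sq_le [Nonempty V] (hdeg : ∀ v, 1 ≤ G.degree v) {t r B : ℕ}
    (hr : 0 < r) (hB : r * (Fintype.card V + 1) < 2 ^ B)
    (hhh : 2 * totalDegree G ≤ 5 * heavyPairs G t) (htr : totalDegree G ≤ (t + 1) ^ 2 * r ^ 2) :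
    mean G ident (additiveBatch (Fintype.card V) t r B) (fun x => (x : ℝ≥0∞) ^ 2) ≤
      ENNReal.ofReal (21 * ((heavyPairs G t : ℝ) / (totalDegree G ^ 2 : ℕ)) ^ 2) := by
  have hn : 0 < Fintype.card V := Fintype.card_pos
  have hD : 0 < totalDegree G := hn.trans_le (card_le_totalDegree hdeg)
  rw [mean_additiveBatch hB]
  simp only [additiveBatch_coe _ hn hr, mul_pow (M := ℝ≥0∞), mean_const_mul, bilinear_weightAt_cast]
  set n := Fintype.card V
  set D := totalDegree G
  set H := heavyPairs G t
  have hn0 : (0 : ℝ) < n := by exact_mod_cast hn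
  have hr0 : (0 : ℝ) < r := by exact_mod_cast hr
  have hD0 : (0 : ℝ) < D := by exact_mod_cast hD
  calc _ ≤ (((n : ℝ≥0∞) * r)⁻¹ ^ 2) ^ 2 * (r ^ 2 * (2 * (n : ℝ≥0∞) ^ 2 / D *
          (2 * (n : ℝ≥0∞) ^ 2 / D * (((t : ℝ≥0∞) + 1)⁻¹ ^ 2 * H))) +
          2 * r ^ 3 * (2 * (n : ℝ≥0∞) ^ 2 / D * ((n / D : ℝ≥0∞) ^ 2 * H)) +
          r ^ 4 * ((n / D : ℝ≥0∞) ^ 2 * H) ^ 2) := by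
        refine mul_le_mul_right ?_ _
        refine (mean_replicate_bilinear_sq_le G ident _ _ pairWeight_comm r).trans ?_
        rw [mean_pairWeight hdeg]
        gcongr
        exacts [mean_pairWeight_sq_le hdeg t, mean_pairWeight_star_le hdeg t]
    _ = ENNReal.ofReal ((((n : ℝ) * r)⁻¹ ^ 2) ^ 2 * (r ^ 2 * (2 * (n : ℝ) ^ 2 / D *
          (2 * (n : ℝ) ^ 2 / D * (((t : ℝ) + 1)⁻¹ ^ 2 * H))) +
          2 * r ^ 3 * (2 * (n : ℝ) ^ 2 / D * ((n / D : ℝ) ^ 2 * H)) +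
          r ^ 4 * ((n / D : ℝ) ^ 2 * H) ^ 2)) := by
        have e1 : ENNReal.ofReal ((n : ℝ) * r)⁻¹ = ((n : ℝ≥0∞) * r)⁻¹ := by
          rw [ENNReal.ofReal_inv_of_pos (by positivity), ENNReal.ofReal_mul (by positivity)]
          simp
        have e2 : ENNReal.ofReal (2 * (n : ℝ) ^ 2 / D) = 2 * (n : ℝ≥0∞) ^ 2 / D := by
          rw [ENNReal.ofReal_div_of_pos hD0, ENNReal.ofReal_mul (by positivity),
            ENNReal.ofReal_pow (by positivity)]
          simp
        have e3 : ENNReal.ofReal ((t : ℝ) + 1)⁻¹ = ((t : ℝ≥0∞) + 1)⁻¹ := by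
          rw [ENNReal.ofReal_inv_of_pos (by positivity),
            ENNReal.ofReal_add (by positivity) (by positivity)]
          simp
        have e4 := natCast_div_eq_ofReal n hD
        rw [e4, ← e1, ← e2, ← e3]
        simp only [← ENNReal.ofReal_natCast, ← ENNReal.ofReal_ofNat]
        repeat first
          | rw [← ENNReal.ofReal_pow (by positivity)]
          | rw [← ENNReal.ofReal_mul (by positivity)]
          | rw [← ENNReal.ofReal_add (by positivity) (by positivity)]
    _ ≤ _ := by
        refine ENNReal.ofReal_le_ofReal ?_
        have h3 : (D : ℝ) ≤ ((t : ℝ) + 1) ^ 2 * r ^ 2 := by exact_mod_cast htr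
        have h4 : (2 : ℝ) * D ≤ 5 * H := by exact_mod_cast hhh
        have h1r : (1 : ℝ) ≤ r := by exact_mod_cast hr
        set μ : ℝ := (H : ℝ) / (D ^ 2 : ℕ) with hμ
        have h7 : 0 ≤ μ := by positivity
        have h6 : (D : ℝ)⁻¹ ≤ 5 / 2 * μ := by
          rw [hμ]
          push_cast
          rw [← mul_div_assoc, le_div_iff₀ (by positivity)]
          field_simp
          linarith
        have hH : (H : ℝ) = μ * D ^ 2 := by
          rw [hμ]
          push_cast
          field_simp
        have h5 : (((n : ℝ) * r)⁻¹ ^ 2) ^ 2 * (r ^ 2 * (2 * (n : ℝ) ^ 2 / D *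
          (2 * (n : ℝ) ^ 2 / D * (((t : ℝ) + 1)⁻¹ ^ 2 * H))) +
          2 * r ^ 3 * (2 * (n : ℝ) ^ 2 / D * ((n / D : ℝ) ^ 2 * H)) +
          r ^ 4 * ((n / D : ℝ) ^ 2 * H) ^ 2) =
          4 * (((t : ℝ) + 1) ^ 2 * r ^ 2)⁻¹ * μ + 4 * (D : ℝ)⁻¹ * (r : ℝ)⁻¹ * μ + μ ^ 2 := by
          rw [hH]
          field_simp
          ring
        have h8 : (((t : ℝ) + 1) ^ 2 * r ^ 2)⁻¹ ≤ (D : ℝ)⁻¹ := by gcongr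
        have h9 : (D : ℝ)⁻¹ * (r : ℝ)⁻¹ ≤ (D : ℝ)⁻¹ :=
          mul_le_of_le_one_right (by positivity) (inv_le_one_of_one_le₀ h1r)
        rw [h5]
        -- Both variance terms are at most `4 * μ / D ≤ 10 * μ ^ 2`; with the squared mean this
        -- makes `21 = 10 + 10 + 1`.
        nlinarith [mul_le_mul_of_nonneg_right (h8.trans h6) h7,
          mul_le_mul_of_nonneg_right (h9.trans h6) h7]

end Mean

end Algorithm

/-! ### Geometric search for the right guess -/

namespace Algorithm

variable {M : Access}

/-- Run the estimators `est i`, `est (i + 1)`, … until the output is at least a quarter of the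
guess `n / 2 ^ i`. -/
noncomputable def search (est : ℕ → Algorithm M ℝ) (n : ℕ) : ℕ → ℕ → Algorithm M ℝ
  | 0, _ => .output 0
  | k + 1, i => (est i).bind fun x =>
      if (n : ℝ) / 2 ^ i ≤ 4 * x then .output x else search est n k (i + 1)

section Search

variable {V : Type*} [Fintype V] [DecidableEq V] {G : SimpleGraph V} [DecidableRel G.Adj]
  {ident : V ↪ ℕ}

/-- Induction on the distance `k` from `i` to the last safe guess `I`, with one failure probability
`δ` and one cost `c` per guess. Since `k < fuel`, the default output `0` is not reached when all
estimates are accurate. -/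
theorem expect_search_le {est : ℕ → Algorithm M ℝ} {n c I : ℕ} {d ε : ℝ} {δ : ℝ≥0∞}
    (hd : 0 < d) (hε : 0 < ε) (hε1 : ε < 1) (hI : d ≤ n / 2 ^ I) (hI' : (n : ℝ) / 2 ^ I < 2 * d)
    (hc : ∀ i ≤ I, (est i).Within c fun _ => True)
    (hest : ∀ i ≤ I, mean G ident (est i)
      (fun x => if |x - d| ≤ ε / 20 * (n / 2 ^ i) then 0 else 1) ≤ δ)
    (k i fuel : ℕ) (hik : i + k = I) (hfuel : k < fuel) :
    expect (run G ident (search est n fuel i))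
      (fun o => if |o.1 - d| ≤ ε * d ∧ o.2 ≤ (k + 1) * c then 0 else 1) ≤ (k + 1 : ℕ) * δ := by
  induction k generalizing i fuel with
  | zero =>
    obtain ⟨fuel, rfl⟩ : ∃ f, fuel = f + 1 := ⟨fuel - 1, by omega⟩
    obtain rfl : i = I := by omega
    rw [search, expect_run_bind]
    simp only [zero_add, Nat.cast_one, one_mul]
    refine le_trans ?_ (hest i le_rfl)
    refine expect_mono_of_support fun o ho => ?_
    have hoc := ((hc i le_rfl).of_mem_support G ident ho).2
    by_cases hacc : |o.1 - d| ≤ ε / 20 * (n / 2 ^ i)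
    · have h1 := abs_le.1 hacc
      -- At `I` the guess is below `2 * d`, so an accurate estimate exceeds `9 / 10 * d` and must be
      -- accepted.
      have hlarge : (n : ℝ) / 2 ^ i ≤ 4 * o.1 := by nlinarith
      have hgood : |o.1 - d| ≤ ε * d := hacc.trans (by nlinarith)
      simp [hlarge, run, expect_pure, hgood, hoc]
    · simp only [if_neg hacc]
      refine (expect_mono_of_support (ψ := fun _ => 1) fun o' _ => ?_).trans_eq (expect_const _ _)
      split_ifs <;> simp
  | succ k ih =>
    obtain ⟨fuel, rfl⟩ : ∃ f, fuel = f + 1 := ⟨fuel - 1, by omega⟩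
    have ih' := ih (i + 1) fuel (by omega) (by omega)
    rw [search, expect_run_bind]
    have hi : i ≤ I := by omega
    have hsplit : ((k + 1 + 1 : ℕ) : ℝ≥0∞) * δ = δ + (k + 1 : ℕ) * δ := by push_cast; ring
    rw [hsplit]
    refine le_trans ?_ (add_le_add_left (hest i hi) _)
    rw [mean, ← expect_const (run G ident (est i)) ((k + 1 : ℕ) * δ), ← expect_add]
    refine expect_mono_of_support fun o ho => ?_
    have hoc := ((hc i hi).of_mem_support G ident ho).2
    by_cases hacc : |o.1 - d| ≤ ε / 20 * (n / 2 ^ i)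
    · rw [if_pos hacc, zero_add]
      by_cases hlarge : (n : ℝ) / 2 ^ i ≤ 4 * o.1
      · have h1 := abs_le.1 hacc
        have hg : (0 : ℝ) ≤ n / 2 ^ i := by positivity
        -- Acceptance gives `g ≤ 4 * (d + g / 20)`, so the absolute error `ε / 20 * g` is within the
        -- relative error allowed.
        have h2 : (n : ℝ) / 2 ^ i ≤ 5 * d := by nlinarith
        have hgood : |o.1 - d| ≤ ε * d := hacc.trans (by nlinarith)
        have hoc' : o.2 ≤ (k + 1 + 1) * c := hoc.trans (Nat.le_mul_of_pos_left _ (by omega))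
        simp [hlarge, run, expect_pure, hgood, hoc']
      · rw [if_neg hlarge]
        refine le_trans (expect_mono_of_support fun o' _ => ?_) ih'
        by_cases hgood : |o'.1 - d| ≤ ε * d ∧ o'.2 ≤ (k + 1) * c
        · have : o.2 + o'.2 ≤ (k + 1 + 1) * c := by
            have := hgood.2
            linarith
          simp [hgood.1, this]
        · rw [if_neg hgood]
          split_ifs <;> simp
    · rw [if_neg hacc]
      refine le_trans ?_ le_self_add
      refine (expect_mono_of_support (ψ := fun _ => 1) fun o' _ => ?_).trans_eq (expect_const _ _)
      split_ifs <;> simp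

end Search

end Algorithm

/-! ### Combining the three estimates -/

/-- The estimate of the average degree obtained from the estimates `h` of the fraction of the edges
between vertices of high degree, `y` of the contribution of the other edges to the average degree,
and `z` of the normalized frequency of edges between random endpoints of high degree. -/
noncomputable def combine (n h y z : ℝ) : ℝ := if h < 1 / 2 then y / (1 - h) else h / (n * z)

/-- Neither branch divides by a small number: `1 - h'` exceeds `1 / 2` in the first, and `z * (n *
d) ≈ h` is nearly `1 / 2` or larger in the second. Accuracy of `z` is needed only for `h ≥ 2 / 5`;
below that, `h' < 1 / 2` and `z` is ignored. -/
theorem abs_combine_sub_le {n d g h h' y z μ e : ℝ} (hn : 0 < n) (hd : 0 < d) (hdg : d ≤ g)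
    (he : 0 < e) (he1 : e ≤ 1 / 100) (hh1 : h ≤ 1) (hμ : μ = h / (n * d))
    (hh' : |h' - h| ≤ e) (hy : |y - d * (1 - h)| ≤ e * g) (hz : 2 / 5 ≤ h → |z - μ| ≤ e * μ) :
    |combine n h' y z - d| ≤ 5 * e * g := by
  have h1 := abs_le.1 hh'
  unfold combine
  split_ifs with hlt
  · have hpos : 0 < 1 - h' := by linarith
    have h2 : y / (1 - h') - d = ((y - d * (1 - h)) + d * (h' - h)) / (1 - h') := by
      field_simp
      ring
    rw [h2, abs_div, abs_of_pos hpos, div_le_iff₀ hpos]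
    calc |y - d * (1 - h) + d * (h' - h)| ≤ |y - d * (1 - h)| + |d * (h' - h)| := abs_add_le _ _
      _ ≤ e * g + d * e := by
        rw [abs_mul, abs_of_pos hd]
        gcongr
      _ ≤ 5 * e * g * (1 - h') := by
        nlinarith [mul_le_mul_of_nonneg_right hdg he.le, mul_pos he (hd.trans_le hdg)]
  · have hh : 49 / 100 ≤ h := by linarith
    have h3 := abs_le.1 (hz (by linarith))
    have hnd : 0 < n * d := by positivity
    have hμh : μ * (n * d) = h := by rw [hμ]; field_simp
    set w := z * (n * d) with hw
    have h4 : h - e * h ≤ w := by nlinarith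
    have h5 : w ≤ h + e * h := by nlinarith
    have hwpos : 48 / 100 ≤ w := by nlinarith
    have hz0 : z ≠ 0 := by
      rintro rfl
      rw [zero_mul] at hw
      linarith
    have h6 : h' / (n * z) - d = d * (h' - w) / w := by
      rw [hw]
      field_simp
    rw [h6, abs_div, abs_mul, abs_of_pos hd, abs_of_pos (by linarith : 0 < w),
      div_le_iff₀ (by linarith)]
    have h7 : |h' - w| ≤ 2 * e := by
      rw [abs_le]
      constructor <;> nlinarith
    have hg : 0 < g := hd.trans_le hdg
    calc d * |h' - w| ≤ g * (2 * e) := by gcongr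
      _ ≤ 5 * e * g * w := by nlinarith [mul_pos he hg]

/-! ### Choice of radius and threshold -/

/-- One more than the integral part of the binary logarithm. -/
def logSize (n : ℕ) : ℕ := Nat.log 2 n + 1

/-- The least power of two whose `p`-th power is at least `2 ^ i`. -/
def radius (p i : ℕ) : ℕ := 2 ^ ((i + p - 1) / p)

/-- The degree above which a vertex counts as heavy, when the guess of the average degree is
`n / 2 ^ i`. -/
def threshold (n p i : ℕ) : ℕ := n * radius p i / 2 ^ i

theorem radius_pos (p i : ℕ) : 0 < radius p i := by
  unfold radius
  positivity

theorem radius_mono (p : ℕ) {i j : ℕ} (h : i ≤ j) : radius p i ≤ radius p j :=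
  Nat.pow_le_pow_right two_pos (Nat.div_le_div_right (by omega))

theorem two_pow_le_radius_pow {p : ℕ} (hp : 0 < p) (i : ℕ) : 2 ^ i ≤ radius p i ^ p := by
  rw [radius, ← pow_mul]
  refine Nat.pow_le_pow_right two_pos ?_
  have := Nat.lt_div_mul_add hp (a := i + p - 1)
  omega

theorem radius_le {p : ℕ} (hp : 0 < p) (i : ℕ) :
    (radius p i : ℝ) ≤ 2 * ((2 : ℝ) ^ i) ^ (1 / (p : ℝ)) := by
  have hp0 : (0 : ℝ) < p := by exact_mod_cast hp
  have h1 : (((i + p - 1) / p : ℕ) : ℝ) ≤ i * (1 / (p : ℝ)) + 1 := by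
    refine Nat.cast_div_le.trans ?_
    have h2 : ((i + p - 1 : ℕ) : ℝ) ≤ i + p := by exact_mod_cast (by omega : i + p - 1 ≤ i + p)
    calc ((i + p - 1 : ℕ) : ℝ) / p ≤ (i + p) / p := by gcongr
      _ = _ := by field_simp
  rw [radius]
  push_cast
  rw [← Real.rpow_natCast 2 ((i + p - 1) / p), ← Real.rpow_natCast 2 i, ← Real.rpow_mul zero_le_two]
  calc (2 : ℝ) ^ (((i + p - 1) / p : ℕ) : ℝ) ≤ 2 ^ (i * (1 / (p : ℝ)) + 1) :=
        Real.rpow_le_rpow_of_exponent_le one_le_two h1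
    _ = _ := by rw [Real.rpow_add two_pos, Real.rpow_one, mul_comm]

/-- With `t + 1 ≥ n * r / 2 ^ i` and `r ^ (p + 2) ≥ 2 ^ i`, the right side is at least `n ^ 2 / 2 ^
i ≥ D`. Here `r ^ p` is the number of pairs examined, with `p = 1` for pair queries and `p = 2` for
additive queries. -/
theorem le_threshold_sq {n p D i : ℕ} (hD : D * 2 ^ i ≤ n ^ 2) :
    D ≤ (threshold n (p + 2) i + 1) ^ 2 * radius (p + 2) i ^ p := by
  set r := radius (p + 2) i with hr
  set t := threshold n (p + 2) i with ht
  have h1 : n * r ≤ (t + 1) * 2 ^ i := by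
    have := Nat.lt_div_mul_add (a := n * r) (b := 2 ^ i) (by positivity)
    have h2 : t = n * r / 2 ^ i := rfl
    rw [← h2] at this
    linarith
  have h3 : 2 ^ i ≤ r ^ (p + 2) := two_pow_le_radius_pow (by omega) i
  refine Nat.le_of_mul_le_mul_right (c := 2 ^ i * 2 ^ i) ?_ (by positivity)
  calc D * (2 ^ i * 2 ^ i) = D * 2 ^ i * 2 ^ i := by ring
    _ ≤ n ^ 2 * r ^ (p + 2) := Nat.mul_le_mul hD h3
    _ = (n * r) ^ 2 * r ^ p := by ring
    _ ≤ ((t + 1) * 2 ^ i) ^ 2 * r ^ p := by gcongr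
    _ = _ := by ring

theorem one_le_logSize (n : ℕ) : 1 ≤ logSize n := Nat.le_add_left _ _

theorem lt_two_pow_logSize (n : ℕ) : n < 2 ^ logSize n :=
  Nat.lt_pow_succ_log_self one_lt_two n

theorem logSize_le {n : ℕ} (hn : 2 ≤ n) : (logSize n : ℝ) ≤ 3 * Real.log n := by
  have h2 := Real.log_two_gt_d9
  have hn0 : (0 : ℝ) < n := by positivity
  have h1 : Real.log 2 ≤ Real.log n := Real.log_le_log two_pos (by exact_mod_cast hn)
  have h3 : (Nat.log 2 n : ℝ) * Real.log 2 ≤ Real.log n := by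
    rw [← Real.log_pow]
    refine Real.log_le_log (by positivity) ?_
    exact_mod_cast Nat.pow_log_le_self 2 (by omega)
  have h4 : (0 : ℝ) ≤ Nat.log 2 n := Nat.cast_nonneg _
  rw [logSize]
  push_cast
  nlinarith

/-! ### The common interface of the two heavy estimators -/

/-- `heavy n i` estimates the normalized frequency of edges between random endpoints of degree
above `threshold n p i`, provided that the average degree is at most `n / 2 ^ i`. -/
structure IsHeavyEstimator.{u} {M : Access} (p κ : ℕ) (heavy : ℕ → ℕ → Algorithm M ℝ≥0) :
    Prop where
  within : ∀ n i, (heavy n i).Within (κ * radius p i * logSize n ^ 2) fun _ => True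
  mean_eq : ∀ {V : Type u} [Fintype V] [DecidableEq V] [Nonempty V] {G : SimpleGraph V}
    [DecidableRel G.Adj] {ident : V ↪ ℕ}, (∀ v, 1 ≤ G.degree v) → ∀ {i : ℕ},
    totalDegree G * 2 ^ i ≤ Fintype.card V ^ 2 →
    (heavy (Fintype.card V) i).mean G ident (fun x => (x : ℝ≥0∞)) =
      heavyPairs G (threshold (Fintype.card V) p i) / (totalDegree G ^ 2 : ℕ)
  mean_sq_le : ∀ {V : Type u} [Fintype V] [DecidableEq V] [Nonempty V] {G : SimpleGraph V}
    [DecidableRel G.Adj] {ident : V ↪ ℕ}, (∀ v, 1 ≤ G.degree v) → ∀ {i : ℕ},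
    totalDegree G * 2 ^ i ≤ Fintype.card V ^ 2 →
    2 * totalDegree G ≤ 5 * heavyPairs G (threshold (Fintype.card V) p i) →
    (heavy (Fintype.card V) i).mean G ident (fun x => (x : ℝ≥0∞) ^ 2) ≤
      ENNReal.ofReal (21 * ((heavyPairs G (threshold (Fintype.card V) p i) : ℝ) /
        (totalDegree G ^ 2 : ℕ)) ^ 2)

/-- The estimator of the frequency of heavy edges that uses pair queries. -/
noncomputable def heavyPairEstimator (n i : ℕ) : Algorithm .pair ℝ≥0 :=
  (Algorithm.pairSample (threshold n 3 i)).average (radius 3 i)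

theorem isHeavyEstimator_pair : IsHeavyEstimator 3 5 heavyPairEstimator where
  within n i := by
    refine ((Algorithm.pairSample_within _).average _).mono ?_ fun _ => id
    rw [mul_comm]
    exact Nat.le_mul_of_pos_right _ (pow_pos (one_le_logSize n) 2)
  mean_eq hdeg _ _ := by
    rw [heavyPairEstimator, Algorithm.mean_average _ (radius_pos _ _),
      Algorithm.mean_pairSample hdeg]
  mean_sq_le hdeg _ hi hh := Algorithm.mean_pairBatch_sq_le hdeg (radius_pos _ _) hh
    (by simpa using le_threshold_sq (p := 1) hi)

/-- Accumulated weights are at most `r * (n + 1)`, so `2 * logSize n` binary digits suffice. As `D ≥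
n`, an admissible guess has `2 ^ i ≤ n`, and `r ≤ 2 ^ i`. -/
theorem radius_mul_lt {V : Type*} [Fintype V] [Nonempty V] {G : SimpleGraph V}
    [DecidableRel G.Adj] (hdeg : ∀ v, 1 ≤ G.degree v) {p i : ℕ} (hp : 0 < p)
    (hi : totalDegree G * 2 ^ i ≤ Fintype.card V ^ 2) :
    radius p i * (Fintype.card V + 1) < 2 ^ (2 * logSize (Fintype.card V)) := by
  classical
  have hn : 0 < Fintype.card V := Fintype.card_pos
  have h1 : 2 ^ i ≤ Fintype.card V := by
    have := (Nat.mul_le_mul_right (2 ^ i) (card_le_totalDegree hdeg)).trans hi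
    rw [sq] at this
    exact Nat.le_of_mul_le_mul_left this hn
  have h2 : radius p i ≤ 2 ^ i := by
    refine Nat.pow_le_pow_right two_pos (Nat.lt_succ_iff.1 ?_)
    rw [Nat.div_lt_iff_lt_mul hp]
    nlinarith [Nat.sub_lt (Nat.add_pos_right i hp) one_pos]
  have h3 := lt_two_pow_logSize (Fintype.card V)
  rw [two_mul, pow_add]
  calc radius p i * (Fintype.card V + 1) ≤ Fintype.card V * 2 ^ logSize (Fintype.card V) :=
        Nat.mul_le_mul (h2.trans h1) h3
    _ < _ := Nat.mul_lt_mul_of_pos_right h3 (by positivity)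

/-- The estimator of the frequency of heavy edges that uses additive queries. -/
noncomputable def heavyAdditiveEstimator (n i : ℕ) : Algorithm .additive ℝ≥0 :=
  Algorithm.additiveBatch n (threshold n 4 i) (radius 4 i) (2 * logSize n)

theorem isHeavyEstimator_additive : IsHeavyEstimator 4 20 heavyAdditiveEstimator where
  within n i := by
    refine (Algorithm.additiveBatch_within _ _ _ _).mono ?_ fun _ => id
    have := one_le_logSize n
    calc 4 * radius 4 i * (1 + (2 * logSize n) ^ 2)
        ≤ 4 * radius 4 i * (logSize n ^ 2 + (2 * logSize n) ^ 2) := by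
          gcongr
          exact Nat.one_le_pow _ _ this
      _ = _ := by ring
  mean_eq hdeg _ hi := Algorithm.mean_additiveBatch_coe hdeg (radius_pos _ _)
    (radius_mul_lt hdeg (by norm_num) hi)
  mean_sq_le hdeg _ hi hh := Algorithm.mean_additiveBatch_sq_le hdeg (radius_pos _ _)
    (radius_mul_lt hdeg (by norm_num) hi) hh (le_threshold_sq (p := 2) hi)

/-! ### The estimate for a single guess -/

namespace Algorithm

variable {M : Access}

/-- The estimate of the average degree for the guess `n / 2 ^ i`. -/
noncomputable def estimate (heavy : ℕ → ℕ → Algorithm M ℝ≥0) (p T n i : ℕ) : Algorithm M ℝ :=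
  ((heavyEdge (threshold n p i)).replicate T).bind fun a =>
    ((lightDegree (threshold n p i)).replicate (T * radius p i)).bind fun b =>
      ((heavy n i).replicate T).bind fun c =>
        .output (combine n ((a.sum : ℝ) / T) ((b.sum : ℝ) / (T * radius p i : ℕ))
          ((c.sum : ℝ) / T))

theorem estimate_within {heavy : ℕ → ℕ → Algorithm M ℝ≥0} {p κ : ℕ}
    (h : IsHeavyEstimator p κ heavy) (T n i : ℕ) :
    (estimate heavy p T n i).Within (T * radius p i * logSize n ^ 2 * (7 + κ)) fun _ => True := by
  refine Within.mono (((heavyEdge_within _).replicate T).bind fun _ _ =>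
    ((lightDegree_within _).replicate _).bind fun _ _ => ((h.within n i).replicate T).bind
      (c' := 0) (Q := fun _ => True) fun _ _ => .output trivial) ?_ fun _ => id
  have h1 : 1 ≤ radius p i := radius_pos p i
  have h2 : 1 ≤ logSize n ^ 2 := Nat.one_le_pow _ _ (one_le_logSize n)
  calc _ = T * 1 * 1 * 3 + T * radius p i * 1 * 4 + T * radius p i * logSize n ^ 2 * κ := by ring
    _ ≤ T * radius p i * logSize n ^ 2 * 3 + T * radius p i * logSize n ^ 2 * 4 +
        T * radius p i * logSize n ^ 2 * κ := by gcongr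
    _ = _ := by ring

/-- Chebyshev for each ingredient and a union bound: the second moments contribute `1`, `2` and
`21`, whence `24`. -/
theorem mean_estimate_le.{u} {heavy : ℕ → ℕ → Algorithm M ℝ≥0} {p κ : ℕ}
    {V : Type u} (h : IsHeavyEstimator.{u} p κ heavy) [Fintype V] [DecidableEq V] [Nonempty V]
    {G : SimpleGraph V} [DecidableRel G.Adj] {ident : V ↪ ℕ} (hdeg : ∀ v, 1 ≤ G.degree v)
    {T i : ℕ} (hT : 0 < T) {e : ℝ} (he : 0 < e) (he1 : e ≤ 1 / 100)
    (hi : totalDegree G * 2 ^ i ≤ Fintype.card V ^ 2) :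
    mean G ident (estimate heavy p T (Fintype.card V) i) (fun x =>
      if |x - (totalDegree G : ℝ) / Fintype.card V| ≤ 5 * e * (Fintype.card V / 2 ^ i)
        then 0 else 1) ≤ ENNReal.ofReal (24 / (T * e ^ 2)) := by
  have hn : 0 < Fintype.card V := Fintype.card_pos
  have hD : 0 < totalDegree G := hn.trans_le (card_le_totalDegree hdeg)
  set n := Fintype.card V with hndef
  set D := totalDegree G with hDdef
  set t := threshold n p i with ht
  set r := radius p i with hr
  set H := heavyPairs G t with hH
  have hr0 : (0 : ℝ) < r := by exact_mod_cast radius_pos p i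
  have hn0 : (0 : ℝ) < n := by exact_mod_cast hn
  have hD0 : (0 : ℝ) < D := by exact_mod_cast hD
  have hT0 : (0 : ℝ) < T := by exact_mod_cast hT
  have hHD : (H : ℝ) ≤ D := by exact_mod_cast heavyPairs_le G t
  set d : ℝ := (D : ℝ) / n with hd
  set g : ℝ := (n : ℝ) / 2 ^ i with hg
  have hg0 : 0 < g := by positivity
  have hd0 : 0 < d := by positivity
  have hdg : d ≤ g := by
    rw [hd, hg, div_le_div_iff₀ hn0 (by positivity), ← sq]
    exact_mod_cast hi
  set μ : ℝ := (H : ℝ) / (D ^ 2 : ℕ) with hμ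
  have hμd : μ = (H : ℝ) / D / (n * d) := by
    rw [hμ, hd]
    push_cast
    field_simp
  have hA : mean G ident ((heavyEdge t : Algorithm M ℝ≥0).replicate T)
      (fun l => if |(l.sum : ℝ) / T - (H : ℝ) / D| ≤ e then 0 else 1) ≤
      ENNReal.ofReal (1 / (T * e ^ 2)) := by
    refine mean_replicate_deviation_le G ident _ T (by positivity) zero_le_one hT he ?_ ?_
    · have := mean_heavyEdge (M := M) (ident := ident) hdeg t 1 one_ne_zero
      simp only [pow_one] at this
      rw [this, natCast_div_eq_ofReal _ hD]
    · rw [mean_heavyEdge hdeg t 2 two_ne_zero, natCast_div_eq_ofReal _ hD]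
      exact ENNReal.ofReal_le_ofReal ((div_le_one hD0).2 hHD)
  have hBmean : mean G ident (lightDegree t : Algorithm M ℝ≥0) (fun x => (x : ℝ≥0∞)) =
      ENNReal.ofReal (d * (1 - H / D)) := by
    have h1 := mean_lightDegree (M := M) (ident := ident) hdeg t
    rw [natCast_div_eq_ofReal _ hn, natCast_div_eq_ofReal _ hn] at h1
    have h2 : (D : ℝ) / n = d * (1 - H / D) + H / n := by
      rw [hd]
      field_simp
      ring
    have h3 : 0 ≤ 1 - (H : ℝ) / D := by
      rw [sub_nonneg, div_le_one hD0]
      exact hHD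
    rw [← hDdef, ← hH, h2, ENNReal.ofReal_add (by positivity) (by positivity)] at h1
    exact (ENNReal.add_left_inj ENNReal.ofReal_ne_top).1 h1
  -- The second moment is at most `2 * g * r * d`; the factor `r` is cancelled by taking `T * r`
  -- samples, and `d ≤ g` does the rest.
  have hB : mean G ident ((lightDegree t : Algorithm M ℝ≥0).replicate (T * r))
      (fun l => if |(l.sum : ℝ) / (T * r : ℕ) - d * (1 - H / D)| ≤ e * g then 0 else 1) ≤
      ENNReal.ofReal (2 / (T * e ^ 2)) := by
    have h3 : 0 ≤ 1 - (H : ℝ) / D := by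
      rw [sub_nonneg, div_le_one hD0]
      exact hHD
    refine (mean_replicate_deviation_le G ident _ (q := 2 * (g * r) * d) (T * r) (by positivity)
      (by positivity) (Nat.mul_pos hT (radius_pos p i)) (by positivity) hBmean ?_).trans ?_
    · refine (mean_lightDegree_sq_le t).trans ?_
      rw [hBmean, ENNReal.ofReal_mul (by positivity : 0 ≤ 2 * (g * r))]
      have h4 : (t : ℝ) ≤ g * r := by
        refine (Nat.cast_div_le (α := ℝ)).trans_eq ?_
        rw [hg]
        push_cast
        ring
      have h5 : (2 : ℝ≥0∞) * t = ENNReal.ofReal (2 * t) := by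
        rw [ENNReal.ofReal_mul zero_le_two]
        simp
      rw [h5]
      refine mul_le_mul' (ENNReal.ofReal_le_ofReal (by gcongr)) (ENNReal.ofReal_le_ofReal ?_)
      have : 0 ≤ (H : ℝ) / D := by positivity
      nlinarith
    · refine ENNReal.ofReal_le_ofReal ?_
      push_cast
      rw [div_le_div_iff₀ (by positivity) (by positivity)]
      have : 2 * (g * r) * d * (T * e ^ 2) ≤ 2 * (g * r) * g * (T * e ^ 2) := by gcongr
      linarith
  -- Failure is charged only when `2 * D ≤ 5 * H`: otherwise the second moment is uncontrolled, but
  -- `combine` ignores this estimate if the edge sample is accurate.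
  have hC : mean G ident ((heavy n i).replicate T)
      (fun l => if 2 * D ≤ 5 * H ∧ ¬ |(l.sum : ℝ) / T - μ| ≤ e * μ then 1 else 0) ≤
      ENNReal.ofReal (21 / (T * e ^ 2)) := by
    by_cases hDH : 2 * D ≤ 5 * H
    · have hμ0 : 0 < μ := by
        have : 0 < H := by omega
        positivity
      have h1 := h.mean_eq (ident := ident) hdeg hi
      rw [natCast_div_eq_ofReal _ (by positivity)] at h1
      refine le_trans (le_of_eq ?_) ((mean_replicate_deviation_le G ident _ (x := e * μ) T hμ0.le
        (by positivity) hT (by positivity) h1 (h.mean_sq_le hdeg hi hDH)).trans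
          (ENNReal.ofReal_le_ofReal ?_))
      · simp only [hDH, true_and, ite_not]
        rfl
      · refine le_of_eq ?_
        change 21 * μ ^ 2 / (T * (e * μ) ^ 2) = _
        field_simp
    · simp [hDH, mean_const]
  have hpt : ∀ a b c : List ℝ≥0,
      (if |combine n ((a.sum : ℝ) / T) ((b.sum : ℝ) / (T * r : ℕ)) ((c.sum : ℝ) / T) - d| ≤
        5 * e * g then (0 : ℝ≥0∞) else 1) ≤
      (if |(a.sum : ℝ) / T - (H : ℝ) / D| ≤ e then 0 else 1) +
      ((if |(b.sum : ℝ) / (T * r : ℕ) - d * (1 - H / D)| ≤ e * g then 0 else 1) +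
      (if 2 * D ≤ 5 * H ∧ ¬ |(c.sum : ℝ) / T - μ| ≤ e * μ then 1 else 0)) := by
    intro a b c
    by_cases ha : |(a.sum : ℝ) / T - (H : ℝ) / D| ≤ e
    · by_cases hb : |(b.sum : ℝ) / (T * r : ℕ) - d * (1 - H / D)| ≤ e * g
      · by_cases hc : 2 * D ≤ 5 * H ∧ ¬ |(c.sum : ℝ) / T - μ| ≤ e * μ
        · rw [if_pos hc]
          refine le_trans ?_ (le_add_left le_add_self)
          split_ifs <;> simp
        · rw [if_pos]
          · exact zero_le
          · refine abs_combine_sub_le hn0 hd0 hdg he he1 ((div_le_one hD0).2 hHD) hμd ha hb ?_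
            intro hh
            by_contra hcon
            refine hc ⟨?_, hcon⟩
            rw [le_div_iff₀ hD0] at hh
            have : (2 : ℝ) * D ≤ 5 * H := by linarith
            exact_mod_cast this
      · rw [if_neg hb]
        refine le_trans ?_ (le_add_left le_self_add)
        split_ifs <;> simp
    · rw [if_neg ha]
      refine le_trans ?_ le_self_add
      split_ifs <;> simp
  rw [estimate]
  simp only [mean_bind, mean_output]
  calc _ ≤ mean G ident ((heavyEdge t : Algorithm M ℝ≥0).replicate T) (fun a =>
        mean G ident ((lightDegree t : Algorithm M ℝ≥0).replicate (T * r)) fun b =>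
        mean G ident ((heavy n i).replicate T) fun c => _) :=
        mean_mono _ _ _ fun a => mean_mono _ _ _ fun b => mean_mono _ _ _ fun c => hpt a b c
    _ ≤ ENNReal.ofReal (1 / (T * e ^ 2)) + (ENNReal.ofReal (2 / (T * e ^ 2)) +
        ENNReal.ofReal (21 / (T * e ^ 2))) := by
        simp only [mean_add, mean_const]
        gcongr
    _ = _ := by
        rw [← ENNReal.ofReal_add (by positivity) (by positivity),
          ← ENNReal.ofReal_add (by positivity) (by positivity)]
        congr 1
        ring

end Algorithm

/-! ### Assembly: success probability and total cost -/

/-- The number of repetitions of the basic estimators. -/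
noncomputable def repetitions (n : ℕ) (ε : ℝ) : ℕ := ⌈50000000 * logSize n / ε ^ 2⌉₊

theorem avgDegree_eq {V : Type*} [Fintype V] [DecidableEq V] (G : SimpleGraph V)
    [DecidableRel G.Adj] : avgDegree G = (totalDegree G : ℝ) / Fintype.card V := by
  rw [avgDegree, totalDegree_eq]
  push_cast
  rfl

/-- The algorithm that estimates the average degree from an estimator of the frequency of edges
between random endpoints of high degree. -/
noncomputable def estimateAverageDegree {M : Access} (heavy : ℕ → ℕ → Algorithm M ℝ≥0) (p n : ℕ)
    (ε : ℝ) : Algorithm M ℝ :=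
  Algorithm.search (Algorithm.estimate heavy p (repetitions n ε) n) n (logSize n) 0

theorem estimateAverageDegree_spec.{u} {M : Access} {heavy : ℕ → ℕ → Algorithm M ℝ≥0} {p κ : ℕ}
    (hp : 0 < p) {V : Type u} (h : IsHeavyEstimator.{u} p κ heavy) [Fintype V] [DecidableEq V]
    [Nonempty V] (G : SimpleGraph V) [DecidableRel G.Adj] (ident : V ↪ ℕ)
    (hdeg : ∀ v, 1 ≤ G.degree v) {ε : ℝ} (hε : 0 < ε) (hε1 : ε < 1) :
    (99 / 100 : ℝ≥0∞) <
      (run G ident (estimateAverageDegree heavy p (Fintype.card V) ε)).toOuterMeasure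
        {o : ℝ × ℕ | |o.1 - avgDegree G| ≤ ε * avgDegree G ∧
          (o.2 : ℝ) ≤ (8100000162 * (7 + κ)) * (1 / ε ^ 2) *
            Real.log (Fintype.card V) ^ 4 *
            ((Fintype.card V : ℝ) / avgDegree G) ^ (1 / (p : ℝ))} := by
  classical
  rw [avgDegree_eq]
  have hn : 0 < Fintype.card V := Fintype.card_pos
  have hn2 : 2 ≤ Fintype.card V := by
    obtain ⟨v⟩ := ‹Nonempty V›
    have := G.degree_lt_card_verts v
    have := hdeg v
    omega
  have hnD : Fintype.card V ≤ totalDegree G := card_le_totalDegree hdeg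
  have hDn : totalDegree G ≤ Fintype.card V ^ 2 := totalDegree_le G
  set n := Fintype.card V with hndef
  set D := totalDegree G with hDdef
  have hD : 0 < D := hn.trans_le hnD
  have hn0 : (0 : ℝ) < n := by exact_mod_cast hn
  have hD0 : (0 : ℝ) < D := by exact_mod_cast hD
  set d : ℝ := (D : ℝ) / n with hd
  have hd0 : 0 < d := by positivity
  have hnd : (n : ℝ) / d = (n : ℝ) ^ 2 / D := by
    rw [hd]
    field_simp
  -- As `n ^ 2 / D = n / d`, this is the last index whose guess `n / 2 ^ I` is still at least `d`.
  set I := Nat.log 2 (n ^ 2 / D) with hIdef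
  set L := logSize n with hL
  set T := repetitions n ε with hT
  have hquot : n ^ 2 / D ≠ 0 := (Nat.div_pos hDn hD).ne'
  have hIle : D * 2 ^ I ≤ n ^ 2 := by
    rw [mul_comm]
    exact (Nat.le_div_iff_mul_le hD).1 (Nat.pow_log_le_self 2 hquot)
  have hIlt : n ^ 2 < 2 ^ (I + 1) * D :=
    (Nat.div_lt_iff_lt_mul hD).1 (Nat.lt_pow_succ_log_self one_lt_two _)
  have hIL : I + 1 ≤ L := by
    refine Nat.succ_le_succ (Nat.log_mono_right ?_)
    refine Nat.div_le_of_le_mul ?_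
    rw [sq]
    exact Nat.mul_le_mul_right n hnD
  have hi : ∀ i ≤ I, D * 2 ^ i ≤ n ^ 2 := fun i hiI =>
    (Nat.mul_le_mul_left D (Nat.pow_le_pow_right two_pos hiI)).trans hIle
  have hIle' : (2 : ℝ) ^ I ≤ n / d := by
    rw [hnd, le_div_iff₀ hD0, mul_comm]
    exact_mod_cast hIle
  have h1L : (1 : ℝ) ≤ L := by exact_mod_cast one_le_logSize n
  have hTle : 50000000 * (L : ℝ) / ε ^ 2 ≤ T := Nat.le_ceil _
  have hTpos : 0 < T := Nat.ceil_pos.2 (by positivity)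
  have hT0 : (0 : ℝ) < T := by exact_mod_cast hTpos
  have hTub : (T : ℝ) ≤ 50000001 * L / ε ^ 2 := by
    refine (Nat.ceil_lt_add_one (by positivity)).le.trans ?_
    have : (1 : ℝ) ≤ L / ε ^ 2 := by
      rw [one_le_div (by positivity)]
      nlinarith
    calc 50000000 * (L : ℝ) / ε ^ 2 + 1 ≤ 50000000 * (L : ℝ) / ε ^ 2 + L / ε ^ 2 := by gcongr
      _ = _ := by ring
  set c := T * radius p I * L ^ 2 * (7 + κ) with hc
  have hbad := Algorithm.expect_search_le (G := G) (ident := ident)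
    (est := Algorithm.estimate heavy p T n) (n := n) (c := c) (I := I) (d := d) (ε := ε)
    (δ := ENNReal.ofReal (24 / (T * (ε / 100) ^ 2))) hd0 hε hε1
    (by rw [le_div_iff₀ (by positivity)]; rwa [le_div_iff₀ hd0, mul_comm] at hIle')
    (by
      rw [hd, div_lt_iff₀ (by positivity), mul_div_assoc', div_mul_eq_mul_div, lt_div_iff₀ hn0]
      have : (n : ℝ) ^ 2 < 2 ^ (I + 1) * D := by exact_mod_cast hIlt
      rw [pow_succ (2 : ℝ) I] at this
      linarith)
    (fun i hiI => (Algorithm.estimate_within h T n i).mono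
      (by have := radius_mono p hiI; rw [hc]; gcongr) fun _ => id)
    (fun i hiI => by
      have := Algorithm.mean_estimate_le h (ident := ident) hdeg (T := T) (i := i) hTpos
        (e := ε / 100) (by positivity) (by linarith) (hi i hiI)
      rwa [show 5 * (ε / 100) = ε / 20 by ring] at this)
    I 0 L (zero_add I) hIL
  set S : Set (ℝ × ℕ) := {o : ℝ × ℕ | |o.1 - d| ≤ ε * d ∧
          (o.2 : ℝ) ≤ (8100000162 * (7 + κ)) * (1 / ε ^ 2) * Real.log n ^ 4 *
            ((n : ℝ) / d) ^ (1 / (p : ℝ))} with hS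
  have hcost : (((I + 1) * c : ℕ) : ℝ) ≤ (8100000162 * (7 + κ)) * (1 / ε ^ 2) * Real.log n ^ 4 *
      ((n : ℝ) / d) ^ (1 / (p : ℝ)) := by
    have hrad : (radius p I : ℝ) ≤ 2 * ((n : ℝ) / d) ^ (1 / (p : ℝ)) := by
      refine (radius_le hp I).trans ?_
      gcongr
    have hlog : (L : ℝ) ≤ 3 * Real.log n := logSize_le hn2
    have hlog0 : 0 ≤ Real.log n := Real.log_natCast_nonneg n
    have hIL' : (I : ℝ) + 1 ≤ L := by exact_mod_cast hIL
    have hpow : (0 : ℝ) ≤ ((n : ℝ) / d) ^ (1 / (p : ℝ)) := by positivity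
    rw [hc]
    push_cast
    -- One factor `L` counts the guesses, one comes from `T`, and two from the cost of the heavy
    -- estimator. The constant is `2 * 50000001 * 3 ^ 4 = 8100000162`.
    calc ((I : ℝ) + 1) * (T * radius p I * L ^ 2 * (7 + κ))
        ≤ L * ((50000001 * L / ε ^ 2) * (2 * ((n : ℝ) / d) ^ (1 / (p : ℝ))) * L ^ 2 * (7 + κ)) := by
          gcongr
      _ = 100000002 * (7 + κ) * (1 / ε ^ 2) * (L : ℝ) ^ 4 * ((n : ℝ) / d) ^ (1 / (p : ℝ)) := by
          ring
      _ ≤ 100000002 * (7 + κ) * (1 / ε ^ 2) * (3 * Real.log n) ^ 4 *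
          ((n : ℝ) / d) ^ (1 / (p : ℝ)) := by
          gcongr
      _ = _ := by ring
  have hle : expect (run G ident (estimateAverageDegree heavy p n ε))
      (fun o => if o ∈ S then 0 else 1) ≤ ENNReal.ofReal (1 / 200) := by
    refine le_trans (le_trans (expect_mono_of_support fun o _ => ?_) hbad) ?_
    · by_cases ho : |o.1 - d| ≤ ε * d ∧ o.2 ≤ (I + 1) * c
      · have : o ∈ S := ⟨ho.1, le_trans (by exact_mod_cast ho.2) hcost⟩
        simp [this]
      · rw [if_neg ho]
        split_ifs <;> simp
    -- At most `L` guesses fail with probability at most `240000 / (T * ε ^ 2) ≤ 0.0048 / L` each, a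
    -- total below `1 / 200`.
    · rw [← ENNReal.ofReal_natCast, ← ENNReal.ofReal_mul (by positivity)]
      refine ENNReal.ofReal_le_ofReal ?_
      have hIL' : ((I + 1 : ℕ) : ℝ) ≤ L := by exact_mod_cast hIL
      rw [div_le_iff₀ (by positivity)] at hTle
      rw [mul_div_assoc', div_le_div_iff₀ (by positivity) (by norm_num)]
      nlinarith
  have hsum := toOuterMeasure_add_expect_not (run G ident (estimateAverageDegree heavy p n ε)) S
  by_contra hcon
  have h1 : (1 : ℝ≥0∞) ≤ ENNReal.ofReal (99 / 100) + ENNReal.ofReal (1 / 200) := by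
    rw [← hsum]
    refine add_le_add ((not_lt.1 hcon).trans_eq ?_) hle
    rw [ENNReal.ofReal_div_of_pos (by norm_num)]
    simp
  rw [← ENNReal.ofReal_add (by norm_num) (by norm_num), ← ENNReal.ofReal_one,
    ENNReal.ofReal_le_ofReal_iff (by norm_num)] at h1
  norm_num at h1

end SublinearGraph

theorem lemma3p8 :
    (∃ (estimateAverageDegree : ℕ → ℝ → SublinearGraph.Algorithm SublinearGraph.Access.pair ℝ)
        (C : ℝ) (k : ℕ),
      ∀ (ε : ℝ), 0 < ε → ε < 1 →
      ∀ (V : Type*) [Fintype V] [DecidableEq V] [Nonempty V]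
        (G : SimpleGraph V) [DecidableRel G.Adj] (ident : V ↪ ℕ),
        (∀ v : V, 1 ≤ G.degree v) →
        (99 / 100 : ℝ≥0∞) <
          (SublinearGraph.run G ident
            (estimateAverageDegree (Fintype.card V) ε)).toOuterMeasure
            {o : ℝ × ℕ |
              |o.1 - SublinearGraph.avgDegree G| ≤ ε * SublinearGraph.avgDegree G ∧
              (o.2 : ℝ) ≤ C * (1 / ε ^ 2) * Real.log (Fintype.card V) ^ k *
                ((Fintype.card V : ℝ) / SublinearGraph.avgDegree G) ^ (1 / 3 : ℝ)}) ∧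
    (∃ (estimateAverageDegree : ℕ → ℝ → SublinearGraph.Algorithm SublinearGraph.Access.additive ℝ)
        (C : ℝ) (k : ℕ),
      ∀ (ε : ℝ), 0 < ε → ε < 1 →
      ∀ (V : Type*) [Fintype V] [DecidableEq V] [Nonempty V]
        (G : SimpleGraph V) [DecidableRel G.Adj] (ident : V ↪ ℕ),
        (∀ v : V, 1 ≤ G.degree v) →
        (99 / 100 : ℝ≥0∞) <
          (SublinearGraph.run G ident
            (estimateAverageDegree (Fintype.card V) ε)).toOuterMeasure
            {o : ℝ × ℕ |
              |o.1 - SublinearGraph.avgDegree G| ≤ ε * SublinearGraph.avgDegree G ∧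
              (o.2 : ℝ) ≤ C * (1 / ε ^ 2) * Real.log (Fintype.card V) ^ k *
                ((Fintype.card V : ℝ) / SublinearGraph.avgDegree G) ^ (1 / 4 : ℝ)}) := by
  refine ⟨⟨SublinearGraph.estimateAverageDegree SublinearGraph.heavyPairEstimator 3,
      8100000162 * (7 + (5 : ℕ)), 4, fun ε hε hε1 V _ _ _ G _ ident hdeg => ?_⟩,
    ⟨SublinearGraph.estimateAverageDegree SublinearGraph.heavyAdditiveEstimator 4,
      8100000162 * (7 + (20 : ℕ)), 4, fun ε hε hε1 V _ _ _ G _ ident hdeg => ?_⟩⟩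
  · exact SublinearGraph.estimateAverageDegree_spec (p := 3) (by norm_num)
      SublinearGraph.isHeavyEstimator_pair G ident hdeg hε hε1
  · exact SublinearGraph.estimateAverageDegree_spec (p := 4) (by norm_num)
      SublinearGraph.isHeavyEstimator_additive G ident hdeg hε hε1
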